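/- Let $\mathfrak g$ be a finite-dimensional simple Lie algebra over $\mathbb C$, let $\langle\cdot,\cdot\rangle$ be its invariant symmetric bilinear form normalized so that long roots have square length $2$, let $h^\vee$ be the dual Coxeter number, and let $\{\gamma_i\}$ be an orthonormal basis of $\mathfrak g$. Let $\ell\in\mathbb N=\{0,1,2,\dots\}$, and let $L_{\widehat{\mathfrak g}}(\ell,0)$ be the simple vertex operator algebra of level $\ell$ on the irreducible quotient of the $\widehat{\mathfrak g}$-module induced from the one-dimensional module on which $\mathfrak g\otimes\mathbb C[t]$ acts by $0$ and the central element by $\ell$, with conformal vector $\omega=\frac1{2(\ell+h^\vee)}\sum_i\gamma_i(-1)\gamma_i(-1)\mathbf 1$. Modules are graded by the eigenvalues of $L(0)$, with finite-dimensional weight spaces and real parts of weights bounded below; $W'$ is the contragredient of $W$. For a module $W$, let $T(W)$ be the space of lowest-weight vectors, that is of vectors annihilated by all $v_n$ with $v$ homogeneous and $\operatorname{wt} v-n-1<0$; it is a $\mathfrak g$-module through $g\mapsto g(0)$. Let $W_1,W_2,W_3,W_4,M_1,M_2$ be $L_{\widehat{\mathfrak g}}(\ell,0)$-modules, and let $u_{(4)}'\in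 T(W_4')$. On $(T(W_1)\otimes T(W_2)\otimes T(W_3))^*$ let $\Omega_{1,2},\Omega_{1,3},\Omega_{2,3}$ be the adjoints of $\sum_i\gamma_i\otimes\gamma_i\otimes1$, $\sum_i\gamma_i\otimes1\otimes\gamma_i$, $\sum_i1\otimes\gamma_i\otimes\gamma_i$, and let $\widetilde H=(\ell+h^\vee)^{-1}(\Omega_{1,2}+\Omega_{1,3}+\Omega_{2,3})$. All series are formal series, with arbitrary complex exponents and coefficients in $(T(W_1)\otimes T(W_2)\otimes T(W_3))^*$. Powers of $x_2+x_0$ and $x_1-x_0$ are expanded in nonnegative powers of $x_0$, powers of $x_1-x_2$ in nonnegative powers of $x_2$, and $(1-x)^{-1}$ in nonnegative powers of $x$. The series $x_1^{\widetilde H}F(x_2/x_1)$ is formed by letting $x_1^{\widetilde H}$ act as $x_1^{n}$ on eigenvectors of $\widetilde H$ of eigenvalue $n$. **(1) Iterates.** Let $\mathcal Y^1$, $\mathcal Y^2$ be intertwining operators of types $\binom{W_4}{M_2\,W_3}$ and $\binom{M_2}{W_1\,W_2}$. Then $\varphi=\langle u_{(4)}',\mathcal Y^1(\mathcal Y^2(\cdot,x_0)\cdot,x_2)\cdot\rangle$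 satisfies $$(\ell+h^\vee)\frac{\partial\varphi}{\partial x_0}=\Big(\frac{\Omega_{1,2}}{x_0}+\frac{\Omega_{1,3}}{x_2+x_0}\Big)\varphi,\qquad(\ell+h^\vee)\frac{\partial\varphi}{\partial x_2}=\Big(\frac{\Omega_{2,3}}{x_2}+\frac{\Omega_{1,3}}{x_2+x_0}\Big)\varphi .$$ The substitution $\widetilde\varphi=\varphi|_{x_2=x_1-x_0}$ is well defined and satisfies $$(\ell+h^\vee)\frac{\partial\widetilde\varphi}{\partial x_0}=\Big(\frac{\Omega_{1,2}}{x_0}-\frac{\Omega_{2,3}}{x_1-x_0}\Big)\widetilde\varphi,\qquad(\ell+h^\vee)\frac{\partial\widetilde\varphi}{\partial x_1}=\Big(\frac{\Omega_{2,3}}{x_1-x_0}+\frac{\Omega_{1,3}}{x_1}\Big)\widetilde\varphi .$$ Moreover $\widetilde\varphi=x_1^{\widetilde H}G(x_0/x_1)$ for a one-variable series $G$ with $$(\ell+h^\vee)\,G'(x)=\Big(\frac{\Omega_{1,2}}{x}-\frac{\Omega_{2,3}}{1-x}\Big)G(x).$$ **(2) Products.** Let $\mathcal Y_1$, $\mathcal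 Y_2$ be intertwining operators of types $\binom{W_4}{W_1\,M_1}$ and $\binom{M_1}{W_2\,W_3}$. Then $\psi=\langle u_{(4)}',\mathcal Y_1(\cdot,x_1)\mathcal Y_2(\cdot,x_2)\cdot\rangle$ satisfies $$(\ell+h^\vee)\frac{\partial\psi}{\partial x_1}=\Big(\frac{\Omega_{1,2}}{x_1-x_2}+\frac{\Omega_{1,3}}{x_1}\Big)\psi,\qquad(\ell+h^\vee)\frac{\partial\psi}{\partial x_2}=\Big(\frac{\Omega_{2,3}}{x_2}-\frac{\Omega_{1,2}}{x_1-x_2}\Big)\psi .$$ Moreover $\psi=x_1^{\widetilde H}F(x_2/x_1)$ for a one-variable series $F$ with $$(\ell+h^\vee)\,F'(x)=\Big(\frac{\Omega_{2,3}}{x}-\frac{\Omega_{1,2}}{1-x}\Big)F(x).$$ -/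

import Mathlib

open scoped TensorProduct

namespace AffineKZ

noncomputable section

section LieData

variable {g : Type*} [LieRing g] [LieAlgebra ℂ g] [FiniteDimensional ℂ g]
  [LieAlgebra.IsSimple ℂ g] (H : LieSubalgebra ℂ g) [H.IsCartanSubalgebra]

/-- The square length of a root `α` for the form induced on the dual of `H` by the Killing form,
that is `α (t_α)`, where `t_α` in `H` represents `α` with respect to the Killing form. -/
def rootSq (α : LieModule.Weight ℂ H g) : ℂ :=
  α ((LieAlgebra.IsKilling.cartanEquivDual H).symm α)

/-- The invariant form on `g` for which the long roots have square length `2`. If `⟨·,·⟩ = c •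
killingForm` then root square lengths get divided by `c`, so `c` is half of the largest square
length of a root for the Killing form. -/
def normalizedForm : LinearMap.BilinForm ℂ g :=
  (((⨆ α : H.root, ‖rootSq H α.1‖ : ℝ) : ℂ) / 2) • killingForm ℂ g

theorem normalizedForm_symm (x y : g) : normalizedForm H x y = normalizedForm H y x := by
  simp [normalizedForm, LieModule.traceForm_comm ℂ g g x y]

theorem normalizedForm_inv (x y z : g) :
    normalizedForm H ⁅x, y⁆ z = - normalizedForm H y ⁅x, z⁆ := by
  have := LieModule.traceForm_lieInvariant ℂ g g x y z
  simp only [normalizedForm, LinearMap.smul_apply, killingForm]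
  rw [this]; simp

theorem neg_normalizedForm_lieInvariant : (-normalizedForm H).lieInvariant g := fun x y z => by
  simp [normalizedForm_inv H x y z]

theorem neg_normalizedForm_isSymm : (-normalizedForm H).IsSymm := ⟨fun x y => by
  simp [normalizedForm_symm H x y]⟩

/-- The cocycle `(x ⊗ tᵐ, y ⊗ tⁿ) ↦ m ⟨x, y⟩ δ_{m+n,0}` on the loop algebra; the residue pairing
of Mathlib carries the opposite sign, which is why the form is negated. See `loop_bracket`. -/
def affineCocycle : LieModule.Cohomology.twoCocycle ℂ (LieAlgebra.loopAlgebra ℂ ℤ g)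
    (TrivialLieModule ℂ (LieAlgebra.loopAlgebra ℂ ℤ g) ℂ) :=
  LieAlgebra.LoopAlgebra.twoCocycleOfBilinear ℂ ℤ g (-normalizedForm H)
    (neg_normalizedForm_lieInvariant H) (neg_normalizedForm_isSymm H)

/-- The affine Lie algebra `g ⊗ ℂ[t, t⁻¹] ⊕ ℂ k` of `g`. -/
def AffineAlgebra : Type _ := LieAlgebra.ofTwoCocycle (affineCocycle H)

instance : LieRing (AffineAlgebra H) :=
  inferInstanceAs (LieRing (LieAlgebra.ofTwoCocycle (affineCocycle H)))

instance : LieAlgebra ℂ (AffineAlgebra H) :=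
  inferInstanceAs (LieAlgebra ℂ (LieAlgebra.ofTwoCocycle (affineCocycle H)))

/-- The underlying vector space of the affine algebra is `g ⊗ ℂ[t, t⁻¹] ⊕ ℂ k`. -/
def AffineAlgebra.ofProd : (LieAlgebra.loopAlgebra ℂ ℤ g × ℂ) ≃ₗ[ℂ] AffineAlgebra H where
  toFun p := LieAlgebra.ofProd (affineCocycle H)
    (p.1, (TrivialLieModule.equiv ℂ (LieAlgebra.loopAlgebra ℂ ℤ g) ℂ).symm p.2)
  invFun a := (((LieAlgebra.ofProd (affineCocycle H)).symm a).1,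
    TrivialLieModule.equiv ℂ (LieAlgebra.loopAlgebra ℂ ℤ g) ℂ
      ((LieAlgebra.ofProd (affineCocycle H)).symm a).2)
  map_add' _ _ := rfl
  map_smul' _ _ := rfl
  left_inv _ := rfl
  right_inv _ := rfl

/-- The element `x ⊗ tⁿ` of the affine algebra. -/
def loop (n : ℤ) : g →ₗ[ℂ] AffineAlgebra H where
  toFun x := AffineAlgebra.ofProd H (AddMonoidAlgebra.single n (1 : ℂ) ⊗ₜ[ℂ] x, 0)
  map_add' x y := by rw [← map_add]; simp [TensorProduct.tmul_add]
  map_smul' c x := by rw [RingHom.id_apply, ← map_smul]; simp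

/-- The central element `k` of the affine algebra. -/
def central : AffineAlgebra H := AffineAlgebra.ofProd H (0, 1)

theorem ofProd_bracket (f f' : LieAlgebra.loopAlgebra ℂ ℤ g) (c c' : ℂ) :
    ⁅AffineAlgebra.ofProd H (f, c), AffineAlgebra.ofProd H (f', c')⁆ =
      AffineAlgebra.ofProd H (⁅f, f'⁆,
        LieAlgebra.LoopAlgebra.residuePairing ℂ ℤ g (-normalizedForm H) f f') := by
  have h := LieAlgebra.bracket_ofTwoCocycle (c := affineCocycle H)
    (AffineAlgebra.ofProd H (f, c)) (AffineAlgebra.ofProd H (f', c'))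
  have e (a : LieAlgebra.loopAlgebra ℂ ℤ g)
      (b : TrivialLieModule ℂ (LieAlgebra.loopAlgebra ℂ ℤ g) ℂ) : ⁅a, b⁆ = 0 :=
    trivial_lie_zero _ _ a b
  simp only [e, add_zero, sub_zero] at h
  exact h

/-- The defining bracket `[x ⊗ tᵐ, y ⊗ tⁿ] = [x, y] ⊗ tᵐ⁺ⁿ + m ⟨x, y⟩ δ_{m+n,0} k`. -/
theorem loop_bracket (x y : g) (m n : ℤ) :
    ⁅loop H m x, loop H n y⁆ =
      loop H (m + n) ⁅x, y⁆ +
        (if m + n = 0 then (m : ℂ) * normalizedForm H x y else 0) • central H := by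
  have key : LieAlgebra.LoopAlgebra.residuePairing ℂ ℤ g (-normalizedForm H)
      (AddMonoidAlgebra.single m (1 : ℂ) ⊗ₜ[ℂ] x) (AddMonoidAlgebra.single n (1 : ℂ) ⊗ₜ[ℂ] y) =
      (if m + n = 0 then (m : ℂ) * normalizedForm H x y else 0) := by
    rw [LieAlgebra.LoopAlgebra.residuePairing_apply_apply,
      LieAlgebra.LoopAlgebra.toFinsupp_single_tmul, LieAlgebra.LoopAlgebra.toFinsupp_single_tmul,
      Finsupp.sum_single_index (by simp)]
    split_ifs with h
    · obtain rfl : n = -m := by omega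
      simp
    · rw [Finsupp.single_eq_of_ne (by omega)]
      simp
  simp only [loop, central, LinearMap.coe_mk, AddHom.coe_mk]
  rw [ofProd_bracket, key, ← map_smul, ← map_add]
  refine congrArg _ (Prod.ext ?_ ?_)
  · simp only [LieAlgebra.ExtendScalars.bracket_tmul, Prod.fst_add, Prod.smul_fst, smul_zero,
      add_zero, AddMonoidAlgebra.single_mul_single, mul_one]
  · simp only [Prod.snd_add, Prod.smul_snd, zero_add, smul_eq_mul, mul_one]

theorem central_bracket (a : AffineAlgebra H) : ⁅central H, a⁆ = 0 := by
  obtain ⟨⟨f, c⟩, rfl⟩ := (AffineAlgebra.ofProd H).surjective a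
  rw [central, ofProd_bracket, map_zero, LinearMap.zero_apply]
  exact (congrArg (fun z => AffineAlgebra.ofProd H (z, 0)) (zero_lie f)).trans
    (map_zero (AffineAlgebra.ofProd H))

/-- The universal enveloping algebra of the affine Lie algebra. -/
abbrev AffineU : Type _ := UniversalEnvelopingAlgebra ℂ (AffineAlgebra H)

/-- The left ideal generated by `g ⊗ ℂ[t]` and `k - ℓ`. -/
def vacuumIdeal (ℓ : ℕ) : Submodule (AffineU H) (AffineU H) :=
  Submodule.span (AffineU H)
    ({a | ∃ (n : ℤ) (x : g), 0 ≤ n ∧ a = UniversalEnvelopingAlgebra.ι ℂ (loop H n x)} ∪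
      {UniversalEnvelopingAlgebra.ι ℂ (central H) - algebraMap ℂ (AffineU H) (ℓ : ℂ)})

/-- The generalized Verma module `V(ℓ, 0)` induced from the one-dimensional module on which `g ⊗
ℂ[t]` acts by `0` and `k` by `ℓ`. -/
abbrev VermaVac (ℓ : ℕ) : Type _ := AffineU H ⧸ vacuumIdeal H ℓ

/-- The sum of all submodules of `V(ℓ, 0)` that do not contain the generating vector. It is the
largest proper submodule, because every submodule is graded and the generating vector spans the
space of degree zero. -/
def maxSubmodule (ℓ : ℕ) : Submodule (AffineU H) (VermaVac H ℓ) :=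
  sSup {N | Submodule.Quotient.mk (1 : AffineU H) ∉ N}

/-- The irreducible quotient `L(ℓ, 0)` of the generalized Verma module. -/
def LVac (ℓ : ℕ) : Type _ := VermaVac H ℓ ⧸ maxSubmodule H ℓ

instance (ℓ : ℕ) : AddCommGroup (LVac H ℓ) :=
  inferInstanceAs (AddCommGroup (VermaVac H ℓ ⧸ maxSubmodule H ℓ))

instance (ℓ : ℕ) : Module (AffineU H) (LVac H ℓ) :=
  inferInstanceAs (Module (AffineU H) (VermaVac H ℓ ⧸ maxSubmodule H ℓ))

instance (ℓ : ℕ) : Module ℂ (LVac H ℓ) :=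
  inferInstanceAs (Module ℂ (VermaVac H ℓ ⧸ maxSubmodule H ℓ))

instance (ℓ : ℕ) : IsScalarTower ℂ (AffineU H) (LVac H ℓ) :=
  inferInstanceAs (IsScalarTower ℂ (AffineU H) (VermaVac H ℓ ⧸ maxSubmodule H ℓ))

instance (ℓ : ℕ) : SMulCommClass (AffineU H) ℂ (LVac H ℓ) :=
  inferInstanceAs (SMulCommClass (AffineU H) ℂ (VermaVac H ℓ ⧸ maxSubmodule H ℓ))

/-- The projection from the enveloping algebra onto `L(ℓ, 0)`. -/
def LVac.mk (ℓ : ℕ) : AffineU H →ₗ[AffineU H] LVac H ℓ :=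
  (maxSubmodule H ℓ).mkQ ∘ₗ (vacuumIdeal H ℓ).mkQ

theorem LVac.mk_surjective (ℓ : ℕ) : Function.Surjective (LVac.mk H ℓ) :=
  (Submodule.mkQ_surjective _).comp (Submodule.mkQ_surjective _)

/-- The vacuum vector `1` of `L(ℓ, 0)`. -/
def vac (ℓ : ℕ) : LVac H ℓ := LVac.mk H ℓ 1

/-- The operator `x(n)`, that is the action of `x ⊗ tⁿ`, on `L(ℓ, 0)`. -/
def act (ℓ : ℕ) (n : ℤ) : g →ₗ[ℂ] Module.End ℂ (LVac H ℓ) :=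
  { toFun := fun x => Algebra.lsmul ℂ ℂ (LVac H ℓ) (UniversalEnvelopingAlgebra.ι ℂ (loop H n x))
    map_add' := fun x y => by simp only [map_add]
    map_smul' := fun c x => by simp only [map_smul, RingHom.id_apply] }


theorem act_apply (ℓ : ℕ) (n : ℤ) (x : g) (w : LVac H ℓ) :
    act H ℓ n x w = UniversalEnvelopingAlgebra.ι ℂ (loop H n x) • w := rfl

theorem act_vac (ℓ : ℕ) (n : ℤ) (hn : 0 ≤ n) (x : g) : act H ℓ n x (vac H ℓ) = 0 := by
  have h : (vacuumIdeal H ℓ).mkQ (UniversalEnvelopingAlgebra.ι ℂ (loop H n x)) = 0 :=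
    (Submodule.Quotient.mk_eq_zero _).mpr (Submodule.subset_span (Or.inl ⟨n, x, hn, rfl⟩))
  rw [act_apply, vac, ← map_smul, smul_eq_mul, mul_one]
  exact (congrArg (maxSubmodule H ℓ).mkQ h).trans (map_zero _)

theorem act_comm (ℓ : ℕ) (m n : ℤ) (x y : g) (w : LVac H ℓ) :
    act H ℓ m x (act H ℓ n y w) = act H ℓ n y (act H ℓ m x w) + act H ℓ (m + n) ⁅x, y⁆ w +
      (if m + n = 0 then (m : ℂ) * normalizedForm H x y else 0) •
        (UniversalEnvelopingAlgebra.ι ℂ (central H) • w) := by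
  have h := congrArg (fun z => UniversalEnvelopingAlgebra.ι ℂ z • w) (loop_bracket H x y m n)
  simp only [LieHom.map_lie, map_add, map_smul, add_smul, LieRing.of_associative_ring_bracket,
    sub_smul, mul_smul] at h
  simp only [act_apply]
  rw [sub_eq_iff_eq_add] at h
  rw [h, smul_assoc]
  abel

theorem central_act_comm (ℓ : ℕ) (n : ℤ) (x : g) (w : LVac H ℓ) :
    act H ℓ n x (UniversalEnvelopingAlgebra.ι ℂ (central H) • w) =
      UniversalEnvelopingAlgebra.ι ℂ (central H) • act H ℓ n x w := by
  have h := congrArg (fun z => UniversalEnvelopingAlgebra.ι ℂ z • w)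
    (central_bracket H (loop H n x))
  simp only [LieHom.map_lie, map_zero, zero_smul, LieRing.of_associative_ring_bracket,
    sub_smul, mul_smul] at h
  rw [act_apply, act_apply]
  exact (sub_eq_zero.mp h).symm

theorem affine_induction {P : AffineAlgebra H → Prop} (hl : ∀ n x, P (loop H n x))
    (hc : ∀ c : ℂ, P (c • central H)) (hadd : ∀ a b, P a → P b → P (a + b))
    (z : AffineAlgebra H) : P z := by
  obtain ⟨⟨f, c⟩, rfl⟩ := (AffineAlgebra.ofProd H).surjective z
  have h2 : P (AffineAlgebra.ofProd H (0, c)) := by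
    convert hc c
    rw [central, ← map_smul, Prod.smul_mk, smul_zero, smul_eq_mul, mul_one]
  have h0 : P (AffineAlgebra.ofProd H (0, 0)) := by
    convert hl 0 0
    rw [map_zero]
    exact map_zero (AffineAlgebra.ofProd H)
  have h1 : P (AffineAlgebra.ofProd H (f, 0)) := by
    induction f using TensorProduct.induction_on with
    | zero => exact h0
    | add a b ha hb =>
      have := hadd _ _ ha hb
      rwa [← map_add, Prod.mk_add_mk, add_zero] at this
    | tmul p x =>
      induction p using AddMonoidAlgebra.induction_linear with
      | zero => rw [TensorProduct.zero_tmul]; exact h0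
      | add a b ha hb =>
        have := hadd _ _ ha hb
        rwa [← map_add, Prod.mk_add_mk, add_zero, ← TensorProduct.add_tmul] at this
      | single n c =>
        convert hl n (c • x)
        simp only [loop, LinearMap.coe_mk, AddHom.coe_mk, ← TensorProduct.smul_tmul,
          AddMonoidAlgebra.smul_single, smul_eq_mul, mul_one]
  have := hadd _ _ h1 h2
  rwa [← map_add, Prod.mk_add_mk, add_zero, zero_add] at this

theorem act_truncated (ℓ : ℕ) (x : g) (w : LVac H ℓ) :
    ∃ N : ℤ, ∀ n : ℤ, N ≤ n → act H ℓ n x w = 0 := by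
  let Q : LVac H ℓ → Prop := fun w => ∀ x : g, ∃ N : ℤ, ∀ n : ℤ, N ≤ n → act H ℓ n x w = 0
  suffices h : ∀ a : AffineU H, ∀ w, Q w → Q (a • w) by
    have hv : Q (vac H ℓ) := fun x => ⟨0, fun n hn => act_vac H ℓ n hn x⟩
    obtain ⟨a, rfl⟩ := LVac.mk_surjective H ℓ w
    have := h a _ hv x
    rwa [vac, ← map_smul, smul_eq_mul, mul_one] at this
  have hadd : ∀ w w', Q w → Q w' → Q (w + w') := by
    intro w w' h h' x
    obtain ⟨N, hN⟩ := h x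
    obtain ⟨N', hN'⟩ := h' x
    refine ⟨max N N', fun n hn => ?_⟩
    rw [map_add, hN n (le_of_max_le_left hn), hN' n (le_of_max_le_right hn), add_zero]
  have hsmul : ∀ (c : ℂ) w, Q w → Q (c • w) := by
    intro c w h x
    obtain ⟨N, hN⟩ := h x
    exact ⟨N, fun n hn => by rw [map_smul, hN n hn, smul_zero]⟩
  have hι : ∀ z : AffineAlgebra H, ∀ w, Q w → Q (UniversalEnvelopingAlgebra.ι ℂ z • w) := by
    intro z
    induction z using affine_induction with
    | hl m y =>
      intro w hw x
      obtain ⟨N, hN⟩ := hw x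
      obtain ⟨N', hN'⟩ := hw ⁅x, y⁆
      refine ⟨max (max N (N' - m)) (1 - m), fun n hn => ?_⟩
      rw [← act_apply, act_comm, hN n (by omega), hN' (n + m) (by omega), if_neg (by omega),
        map_zero, zero_smul, add_zero, add_zero]
    | hc c =>
      intro w hw
      rw [map_smul, smul_assoc]
      refine hsmul c _ fun x => ?_
      obtain ⟨N, hN⟩ := hw x
      exact ⟨N, fun n hn => by rw [central_act_comm, hN n hn, smul_zero]⟩
    | hadd a b ha hb =>
      intro w hw
      rw [map_add, add_smul]
      exact hadd _ _ (ha w hw) (hb w hw)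
  intro a
  obtain ⟨a, rfl⟩ : ∃ b, UniversalEnvelopingAlgebra.mkAlgHom ℂ (AffineAlgebra H) b = a :=
    RingCon.mk'_surjective _ a
  induction a using TensorAlgebra.induction with
  | algebraMap r =>
    intro w hw
    rw [AlgHom.commutes, algebraMap_smul]
    exact hsmul r w hw
  | ι z => exact hι z
  | mul a b ha hb =>
    intro w hw
    rw [map_mul, mul_smul]
    exact ha _ (hb w hw)
  | add a b ha hb =>
    intro w hw
    rw [map_add, add_smul]
    exact hadd _ _ (ha w hw) (hb w hw)

end LieData

section Fields

variable (M : Type*) [AddCommGroup M] [Module ℂ M]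

/-- The fields `a(z) = ∑ a_n z^(-n-1)` on a vector space `M`: families of endomorphisms `a_n` such
that for each `w` one has `a_n w = 0` for all large `n`. -/
def FieldOn : Submodule ℂ (ℤ → Module.End ℂ M) where
  carrier := {a | ∀ w, ∃ N : ℤ, ∀ n : ℤ, N ≤ n → a n w = 0}
  add_mem' := by
    intro a b ha hb w
    obtain ⟨N, hN⟩ := ha w
    obtain ⟨N', hN'⟩ := hb w
    exact ⟨max N N', fun n hn => by
      simp [hN n (le_of_max_le_left hn), hN' n (le_of_max_le_right hn)]⟩
  zero_mem' := fun w => ⟨0, fun n _ => rfl⟩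
  smul_mem' := by
    intro c a ha w
    obtain ⟨N, hN⟩ := ha w
    exact ⟨N, fun n hn => by simp [hN n hn]⟩

/-- The field that is constantly the identity. -/
def idField : FieldOn M :=
  ⟨fun n => if n = -1 then LinearMap.id else 0, fun w => ⟨0, fun n hn => by
    simp [show n ≠ -1 by omega]⟩⟩

variable {M}

/-- The `i`-th summand of the `n`-th product of fields. -/
def prodTerm (n : ℤ) (a b : ℤ → Module.End ℂ M) (m : ℤ) (w : M) (i : ℕ) : M :=
  ((-1 : ℂ) ^ i * (Ring.choose n i : ℂ)) •
    (a (n - i) (b (m + i) w) - (-1 : ℂ) ^ n • b (n + m - i) (a i w))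

theorem prodTerm_finite (n : ℤ) (a b : FieldOn M) (m : ℤ) (w : M) :
    (Function.support (prodTerm n a.1 b.1 m w)).Finite := by
  obtain ⟨N, hN⟩ := a.2 w
  obtain ⟨N', hN'⟩ := b.2 w
  refine (Set.finite_Iio (max N (N' - m)).toNat).subset fun i hi => ?_
  by_contra h
  rw [Set.mem_Iio, not_lt] at h
  refine hi ?_
  rw [prodTerm, hN i (by omega), hN' (m + i) (by omega)]
  simp

/-- The `n`-th product of the fields `a` and `b`, namely the residue in `y` of `(y - x)ⁿ a(y) b(x)
- (-x + y)ⁿ b(x) a(y)`, where the first power is expanded in nonnegative powers of `x` and the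
second in nonnegative powers of `y`. -/
def nthProdFun (n : ℤ) (a b : FieldOn M) : FieldOn M :=
  ⟨fun m =>
    { toFun := fun w => ∑ᶠ i : ℕ, prodTerm n a.1 b.1 m w i
      map_add' := fun w w' => by
        rw [← finsum_add_distrib (prodTerm_finite n a b m w) (prodTerm_finite n a b m w')]
        refine finsum_congr fun i => ?_
        simp only [prodTerm, map_add, ← smul_add]
        congr 1
        rw [smul_add]
        abel
      map_smul' := fun c w => by
        rw [RingHom.id_apply, smul_finsum' c (prodTerm_finite n a b m w)]
        refine finsum_congr fun i => ?_
        simp only [prodTerm, map_smul]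
        module },
    by
      intro w
      obtain ⟨N, hN⟩ := a.2 w
      obtain ⟨N', hN'⟩ := b.2 w
      choose f hf using fun i : ℕ => b.2 (a.1 i w)
      refine ⟨max N' (∑ i ∈ Finset.range N.toNat, |f i| + |n| + N.toNat + 1), fun m hm => ?_⟩
      refine finsum_eq_zero_of_forall_eq_zero fun i => ?_
      have h1 : b.1 (m + i) w = 0 := hN' _ (by omega)
      have h2 : b.1 (n + m - i) (a.1 i w) = 0 := by
        by_cases hi : N ≤ i
        · rw [hN i hi, map_zero]
        · refine hf i _ ?_
          have : |f i| ≤ ∑ i ∈ Finset.range N.toNat, |f i| :=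
            Finset.single_le_sum (f := fun i => |f i|) (fun j _ => abs_nonneg _)
              (Finset.mem_range.mpr (by omega))
          have := le_abs_self (f i)
          have := neg_abs_le n
          omega
      simp [prodTerm, h1, h2]⟩

/-- The `n`-th product of fields as a bilinear map. -/
def nthProd (n : ℤ) : FieldOn M →ₗ[ℂ] FieldOn M →ₗ[ℂ] FieldOn M :=
  LinearMap.mk₂ ℂ (nthProdFun n)
    (fun a a' b => Subtype.ext <| funext fun m => LinearMap.ext fun w => by
      simp only [Submodule.coe_add, Pi.add_apply, LinearMap.add_apply, nthProdFun,
        LinearMap.coe_mk, AddHom.coe_mk]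
      rw [← finsum_add_distrib (prodTerm_finite n a b m w) (prodTerm_finite n a' b m w)]
      refine finsum_congr fun i => ?_
      simp only [prodTerm, Pi.add_apply, LinearMap.add_apply, map_add]
      module)
    (fun c a b => Subtype.ext <| funext fun m => LinearMap.ext fun w => by
      simp only [Submodule.coe_smul, Pi.smul_apply, LinearMap.smul_apply, nthProdFun,
        LinearMap.coe_mk, AddHom.coe_mk]
      rw [smul_finsum' c (prodTerm_finite n a b m w)]
      refine finsum_congr fun i => ?_
      simp only [prodTerm, Pi.smul_apply, LinearMap.smul_apply, map_smul]
      module)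
    (fun a b b' => Subtype.ext <| funext fun m => LinearMap.ext fun w => by
      simp only [Submodule.coe_add, Pi.add_apply, LinearMap.add_apply, nthProdFun,
        LinearMap.coe_mk, AddHom.coe_mk]
      rw [← finsum_add_distrib (prodTerm_finite n a b m w) (prodTerm_finite n a b' m w)]
      refine finsum_congr fun i => ?_
      simp only [prodTerm, Pi.add_apply, LinearMap.add_apply, map_add]
      module)
    (fun c a b => Subtype.ext <| funext fun m => LinearMap.ext fun w => by
      simp only [Submodule.coe_smul, Pi.smul_apply, LinearMap.smul_apply, nthProdFun,
        LinearMap.coe_mk, AddHom.coe_mk]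
      rw [smul_finsum' c (prodTerm_finite n a b m w)]
      refine finsum_congr fun i => ?_
      simp only [prodTerm, Pi.smul_apply, LinearMap.smul_apply, map_smul]
      module)

theorem nthProd_apply (n : ℤ) (a b : FieldOn M) (m : ℤ) (w : M) :
    (nthProd n a b).1 m w = ∑ᶠ i : ℕ, prodTerm n a.1 b.1 m w i := rfl

/-- The field `[D, a(x)]` for an endomorphism `D`. -/
def bracketField (D : Module.End ℂ M) (a : FieldOn M) : FieldOn M :=
  ⟨fun m => D ∘ₗ a.1 m - a.1 m ∘ₗ D, fun w => by
    obtain ⟨N, hN⟩ := a.2 w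
    obtain ⟨N', hN'⟩ := a.2 (D w)
    exact ⟨max N N', fun n hn => by
      simp [hN n (le_of_max_le_left hn), hN' n (le_of_max_le_right hn)]⟩⟩

theorem bracketField_nthProd (D : Module.End ℂ M) (n : ℤ) (a b : FieldOn M) :
    bracketField D (nthProd n a b) =
      nthProd n (bracketField D a) b + nthProd n a (bracketField D b) := by
  ext m w
  change D (∑ᶠ i : ℕ, _) - ∑ᶠ i : ℕ, _ = ∑ᶠ i : ℕ, _ + ∑ᶠ i : ℕ, _
  rw [← finsum_add_distrib (prodTerm_finite n (bracketField D a) b m w)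
    (prodTerm_finite n a (bracketField D b) m w), sub_eq_iff_eq_add]
  have h1 := D.toAddMonoidHom.map_finsum (prodTerm_finite n a b m w)
  rw [LinearMap.toAddMonoidHom_coe] at h1
  rw [h1, ← finsum_add_distrib _ (prodTerm_finite n a b m (D w))]
  · refine finsum_congr fun i => ?_
    simp only [prodTerm, bracketField, LinearMap.sub_apply, LinearMap.comp_apply, map_sub,
      map_smul]
    module
  · refine ((prodTerm_finite n (bracketField D a) b m w).union
      (prodTerm_finite n a (bracketField D b) m w)).subset fun i hi => ?_
    by_contra h
    rw [Set.mem_union, not_or, Function.notMem_support, Function.notMem_support] at h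
    exact hi (by simp only [h.1, h.2, add_zero])

end Fields

section VOA

variable {g : Type*} [LieRing g] [LieAlgebra ℂ g] [FiniteDimensional ℂ g]
  [LieAlgebra.IsSimple ℂ g] (H : LieSubalgebra ℂ g) [H.IsCartanSubalgebra]

/-- An orthonormal basis of `g` for the normalized invariant form. -/
structure OrthoBasis (ι : Type*) [DecidableEq ι] where
  toBasis : Module.Basis ι ℂ g
  orthonormal : ∀ i j, normalizedForm H (toBasis i) (toBasis j) = if i = j then 1 else 0

variable {H} {ι : Type*} [Fintype ι] [DecidableEq ι]

/-- The dual Coxeter number `h^∨`: the Casimir element `∑ γᵢ γᵢ` acts on the adjoint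
representation as the scalar `2 h^∨`, so its trace there is `2 h^∨ dim g`. -/
def dualCoxeter (γ : OrthoBasis H ι) : ℂ :=
  LinearMap.trace ℂ g (∑ i, LieAlgebra.ad ℂ g (γ.toBasis i) ∘ₗ LieAlgebra.ad ℂ g (γ.toBasis i)) /
    (2 * Module.finrank ℂ g)

variable (H) in
/-- The field `x(z) = ∑ x(n) z^(-n-1)` on `L(ℓ, 0)`. -/
def current (ℓ : ℕ) : g →ₗ[ℂ] FieldOn (LVac H ℓ) where
  toFun x := ⟨fun n => act H ℓ n x, act_truncated H ℓ x⟩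
  map_add' x y := by ext n w; simp
  map_smul' c x := by ext n w; simp

variable (H) in
/-- The space of all vertex operators of the vertex operator algebra `L(ℓ, 0)`: the smallest space
of fields that contains the identity and all `x(z)` and that is closed under all `n`-th products.
-/
def vertexOperators (ℓ : ℕ) : Submodule ℂ (FieldOn (LVac H ℓ)) :=
  sInf {P | idField (LVac H ℓ) ∈ P ∧ (∀ x, current H ℓ x ∈ P) ∧
    ∀ (n : ℤ) (a b : FieldOn (LVac H ℓ)), a ∈ P → b ∈ P → nthProd n a b ∈ P}

/-- The field `a` is the vertex operator `Y(v, z)` of `v` in `L(ℓ, 0)`. By the state-field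
correspondence, `a ↦ a_{-1} 1` is a bijection from the space of vertex operators onto `L(ℓ, 0)`,
so that each `v` has exactly one such `a`; the resulting map `Y` is the one with `Y(x(-1) 1, z) =
x(z)`. -/
def IsVertexOperator {ℓ : ℕ} (v : LVac H ℓ) (a : FieldOn (LVac H ℓ)) : Prop :=
  a ∈ vertexOperators H ℓ ∧ a.1 (-1) (vac H ℓ) = v

theorem isVertexOperator_current (ℓ : ℕ) (x : g) :
    IsVertexOperator (act H ℓ (-1) x (vac H ℓ)) (current H ℓ x) :=
  ⟨Submodule.mem_sInf.mpr fun _ hP => hP.2.1 x, rfl⟩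

/-- The conformal vector `ω = (2 (ℓ + h^∨))⁻¹ ∑ γᵢ(-1) γᵢ(-1) 1`. -/
def omega (ℓ : ℕ) (γ : OrthoBasis H ι) : LVac H ℓ :=
  (2 * ((ℓ : ℂ) + dualCoxeter γ))⁻¹ •
    ∑ i, act H ℓ (-1) (γ.toBasis i) (act H ℓ (-1) (γ.toBasis i) (vac H ℓ))

/-- The vertex operator of the conformal vector, see `isVertexOperator_omegaField`. -/
def omegaField (ℓ : ℕ) (γ : OrthoBasis H ι) : FieldOn (LVac H ℓ) :=
  (2 * ((ℓ : ℂ) + dualCoxeter γ))⁻¹ •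
    ∑ i, nthProd (-1) (current H ℓ (γ.toBasis i)) (current H ℓ (γ.toBasis i))

/-- The Virasoro operator `L(n)`, the coefficient of `z^(-n-2)` in `Y(ω, z)`, on `L(ℓ, 0)`. -/
def virV (ℓ : ℕ) (γ : OrthoBasis H ι) (n : ℤ) : Module.End ℂ (LVac H ℓ) :=
  (omegaField ℓ γ).1 (n + 1)

theorem isVertexOperator_omegaField (ℓ : ℕ) (γ : OrthoBasis H ι) :
    IsVertexOperator (omega ℓ γ) (omegaField ℓ γ) := by
  refine ⟨Submodule.mem_sInf.mpr fun P hP => P.smul_mem _ (P.sum_mem fun i _ =>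
    hP.2.2 _ _ _ (hP.2.1 _) (hP.2.1 _)), ?_⟩
  simp only [omegaField, omega, Submodule.coe_smul, Pi.smul_apply, LinearMap.smul_apply,
    AddSubmonoidClass.coe_finsetSum, Finset.sum_apply, LinearMap.sum_apply]
  refine congrArg _ (Finset.sum_congr rfl fun i _ => ?_)
  have hcur : ∀ (n : ℤ) (w : LVac H ℓ),
      (current H ℓ (γ.toBasis i)).1 n w = act H ℓ n (γ.toBasis i) w := fun _ _ => rfl
  rw [nthProd_apply, finsum_eq_single _ 0]
  · simp [prodTerm, hcur, act_vac]
  · intro j hj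
    simp only [prodTerm, hcur]
    rw [act_vac H ℓ (-1 + j) (by omega), act_vac H ℓ j (by omega)]
    simp

theorem bracketField_current (ℓ : ℕ) (x y : g) :
    bracketField (act H ℓ 0 x) (current H ℓ y) = current H ℓ ⁅x, y⁆ := by
  ext m w
  change act H ℓ 0 x (act H ℓ m y w) - act H ℓ m y (act H ℓ 0 x w) = act H ℓ m ⁅x, y⁆ w
  rw [act_comm]
  simp

theorem casimir_invariant (γ : OrthoBasis H ι) {N : Type*} [AddCommGroup N] [Module ℂ N]
    (Φ : g →ₗ[ℂ] g →ₗ[ℂ] N) (x : g) :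
    ∑ i, (Φ ⁅x, γ.toBasis i⁆ (γ.toBasis i) + Φ (γ.toBasis i) ⁅x, γ.toBasis i⁆) = 0 := by
  have hrep : ∀ y : g, y = ∑ j, normalizedForm H y (γ.toBasis j) • γ.toBasis j := by
    intro y
    have h : ∀ j, normalizedForm H y (γ.toBasis j) = γ.toBasis.repr y j := by
      intro j
      conv_lhs => rw [← γ.toBasis.sum_repr y]
      simp only [map_sum, map_smul, LinearMap.sum_apply, LinearMap.smul_apply, γ.orthonormal]
      simp
    simp_rw [h]
    exact (γ.toBasis.sum_repr y).symm
  have hanti : ∀ i j, normalizedForm H ⁅x, γ.toBasis i⁆ (γ.toBasis j) =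
      - normalizedForm H ⁅x, γ.toBasis j⁆ (γ.toBasis i) := fun i j => by
    rw [normalizedForm_inv, normalizedForm_symm]
  have h1 : ∀ i, Φ ⁅x, γ.toBasis i⁆ (γ.toBasis i) =
      ∑ j, normalizedForm H ⁅x, γ.toBasis i⁆ (γ.toBasis j) •
        Φ (γ.toBasis j) (γ.toBasis i) := fun i => by
    conv_lhs => rw [hrep ⁅x, γ.toBasis i⁆]
    simp
  have h2 : ∀ i, Φ (γ.toBasis i) ⁅x, γ.toBasis i⁆ =
      ∑ j, normalizedForm H ⁅x, γ.toBasis i⁆ (γ.toBasis j) •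
        Φ (γ.toBasis i) (γ.toBasis j) := fun i => by
    conv_lhs => rw [hrep ⁅x, γ.toBasis i⁆]
    simp
  rw [Finset.sum_add_distrib]
  simp_rw [h1, h2]
  rw [Finset.sum_comm, ← Finset.sum_add_distrib]
  refine Finset.sum_eq_zero fun i _ => ?_
  rw [← Finset.sum_add_distrib]
  refine Finset.sum_eq_zero fun j _ => ?_
  rw [hanti j i, neg_smul, neg_add_cancel]

theorem virV_act_comm (ℓ : ℕ) (γ : OrthoBasis H ι) (n : ℤ) (x : g) (v : LVac H ℓ) :
    virV ℓ γ n (act H ℓ 0 x v) = act H ℓ 0 x (virV ℓ γ n v) := by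
  have h : ∑ i, bracketField (act H ℓ 0 x)
      (nthProd (-1) (current H ℓ (γ.toBasis i)) (current H ℓ (γ.toBasis i))) = 0 := by
    simp_rw [bracketField_nthProd, bracketField_current]
    exact casimir_invariant γ ((nthProd (-1)).compl₁₂ (current H ℓ) (current H ℓ)) x
  have h' := congrArg (fun a : FieldOn (LVac H ℓ) => a.1 (n + 1) v) h
  simp only [bracketField, AddSubmonoidClass.coe_finsetSum, Finset.sum_apply,
    LinearMap.sum_apply, LinearMap.sub_apply, LinearMap.comp_apply, Finset.sum_sub_distrib,
    ← map_sum, Submodule.coe_zero, Pi.zero_apply, LinearMap.zero_apply, sub_eq_zero] at h'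
  simp only [virV, omegaField, Submodule.coe_smul, Pi.smul_apply, LinearMap.smul_apply, map_smul,
    AddSubmonoidClass.coe_finsetSum, Finset.sum_apply, LinearMap.sum_apply, map_sum] at h' ⊢
  rw [h']

end VOA

section Modules

variable {g : Type*} [LieRing g] [LieAlgebra ℂ g] [FiniteDimensional ℂ g]
  [LieAlgebra.IsSimple ℂ g] {H : LieSubalgebra ℂ g} [H.IsCartanSubalgebra]
  {ι : Type*} [Fintype ι] [DecidableEq ι]

/-- A module for the vertex operator algebra `L(ℓ, 0)`; `Y v n` is the coefficient `v_n` of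
`z^(-n-1)` in `Y_W(v, z)`. The Jacobi identity is written as the equality of the coefficients of
`x₀^(-p-1) x₁^(-q-1) x₂^(-r-1)`. The space is the direct sum of the finite-dimensional eigenspaces
of `L(0)`, and the real parts of the eigenvalues are bounded below. -/
structure LModule (ℓ : ℕ) (γ : OrthoBasis H ι) (W : Type*) [AddCommGroup W] [Module ℂ W] where
  Y : LVac H ℓ →ₗ[ℂ] (ℤ → Module.End ℂ W)
  truncated : ∀ v w, ∃ N : ℤ, ∀ n : ℤ, N ≤ n → Y v n w = 0
  vacuum : ∀ n : ℤ, Y (vac H ℓ) n = if n = -1 then LinearMap.id else 0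
  jacobi : ∀ (u v : LVac H ℓ) (a : FieldOn (LVac H ℓ)), IsVertexOperator u a →
    ∀ (w : W) (p q r : ℤ),
      ∑ᶠ i : ℕ, ((-1 : ℂ) ^ i * (Ring.choose p i : ℂ)) •
          (Y u (p + q - i) (Y v (r + i) w) - (-1 : ℂ) ^ p • Y v (p + r - i) (Y u (q + i) w)) =
        ∑ᶠ i : ℕ, (Ring.choose q i : ℂ) • Y (a.1 (p + i) v) (q + r - i) w
  derivative : ∀ (v : LVac H ℓ) (n : ℤ), Y (virV ℓ γ (-1) v) n = (-n : ℂ) • Y v (n - 1)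
  grading : ⨆ h : ℂ, Module.End.eigenspace (Y (omega ℓ γ) 1) h = ⊤
  finite_weight : ∀ h : ℂ, FiniteDimensional ℂ (Module.End.eigenspace (Y (omega ℓ γ) 1) h)
  lower_bound : ∃ N : ℝ, ∀ h : ℂ, h.re < N → Module.End.eigenspace (Y (omega ℓ γ) 1) h = ⊥

namespace LModule

variable {ℓ : ℕ} {γ : OrthoBasis H ι} {W : Type*} [AddCommGroup W] [Module ℂ W]
  (A : LModule ℓ γ W)

/-- The operator `L(n)` on a module. -/
def L (n : ℤ) : Module.End ℂ W := A.Y (omega ℓ γ) (n + 1)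

/-- The space of conformal weight `h`. -/
def weightSpace (h : ℂ) : Submodule ℂ W := Module.End.eigenspace (A.L 0) h

/-- The space `T(W)` of lowest-weight vectors: the vectors annihilated by every operator of
negative degree, where `v_n` has degree `k - n - 1` if `v` has conformal weight `k`. -/
def top : Submodule ℂ W where
  carrier := {w | ∀ (k : ℤ) (v : LVac H ℓ) (n : ℤ), virV ℓ γ 0 v = (k : ℂ) • v →
    k - n - 1 < 0 → A.Y v n w = 0}
  add_mem' := fun ha hb k v n hv hn => by rw [map_add, ha k v n hv hn, hb k v n hv hn, add_zero]
  zero_mem' := fun k v n hv hn => map_zero _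
  smul_mem' := fun c w hw k v n hv hn => by rw [map_smul, hw k v n hv hn, smul_zero]

theorem Y_act_comm (x : g) (v : LVac H ℓ) (n : ℤ) (w : W) :
    A.Y (act H ℓ (-1) x (vac H ℓ)) 0 (A.Y v n w) =
      A.Y v n (A.Y (act H ℓ (-1) x (vac H ℓ)) 0 w) + A.Y (act H ℓ 0 x v) n w := by
  have h := A.jacobi _ v _ (isVertexOperator_current ℓ x) w 0 0 n
  rw [finsum_eq_single _ 0 (fun i hi => by simp [Ring.choose_zero_ite, hi]),
    finsum_eq_single _ 0 (fun i hi => by simp [Ring.choose_zero_ite, hi])] at h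
  simp only [Ring.choose_zero_right, pow_zero, mul_one, one_smul, Nat.cast_zero,
    add_zero, sub_zero, zero_add, zpow_zero] at h
  rw [sub_eq_iff_eq_add] at h
  rw [h, add_comm]
  rfl

/-- The action of `x(0)`, that is of `x` in `g`, on `T(W)`. -/
def topAct (x : g) : Module.End ℂ A.top :=
  (A.Y (act H ℓ (-1) x (vac H ℓ)) 0).restrict (p := A.top) (q := A.top) fun w hw k v n hv hn => by
    have h := A.Y_act_comm x v n w
    rw [hw k v n hv hn, map_zero, hw k (act H ℓ 0 x v) n _ hn, add_zero] at h
    · exact h.symm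
    · rw [virV_act_comm, hv, map_smul]

/-- The coefficient of `z^(-n-1)` in the contragredient vertex operator `⟨Y'(v, z) f, w⟩ = ⟨f,
Y(e^(z L(1)) (-z⁻²)^(L(0)) v, z⁻¹) w⟩` for `v` of conformal weight `k`. -/
def contraMode (k : ℤ) (v : LVac H ℓ) (n : ℤ) (f : Module.Dual ℂ W) (w : W) : ℂ :=
  (-1 : ℂ) ^ k * ∑ᶠ j : ℕ, ((j.factorial : ℂ))⁻¹ *
    f (A.Y (((virV ℓ γ 1) ^ j) v) (2 * k - n - 2 - j) w)

/-- The functional `f` belongs to `T(W')`: it lies in the contragredient module `W'`, the graded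
dual of `W`, and it is annihilated by the operators of negative degree of `W'`. -/
structure IsTopDual (f : Module.Dual ℂ W) : Prop where
  graded : ∃ S : Finset ℂ, ∀ h ∉ S, ∀ w ∈ A.weightSpace h, f w = 0
  annihilated : ∀ (k : ℤ) (v : LVac H ℓ) (n : ℤ), virV ℓ γ 0 v = (k : ℂ) • v →
    k - n - 1 < 0 → ∀ w : W, A.contraMode k v n f w = 0

end LModule

/-- An intertwining operator of type `(W₃; W₁ W₂)`; `mode n w₁` is the coefficient of `z^(-n-1)`
in `𝒴(w₁, z)`. The Jacobi identity is written as the equality of the coefficients of `x₀^(-p-1)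
x₁^(-q-1) x₂^(-r-1)`. -/
structure Intertwiner {ℓ : ℕ} {γ : OrthoBasis H ι}
    {W₁ W₂ W₃ : Type*} [AddCommGroup W₁] [Module ℂ W₁] [AddCommGroup W₂] [Module ℂ W₂]
    [AddCommGroup W₃] [Module ℂ W₃]
    (A₁ : LModule ℓ γ W₁) (A₂ : LModule ℓ γ W₂) (A₃ : LModule ℓ γ W₃) where
  mode : ℂ → W₁ →ₗ[ℂ] W₂ →ₗ[ℂ] W₃
  truncated : ∀ (w₁ : W₁) (w₂ : W₂) (n : ℂ), ∃ N : ℕ, ∀ m : ℕ, N ≤ m → mode (n + m) w₁ w₂ = 0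
  jacobi : ∀ (v : LVac H ℓ) (w₁ : W₁) (w₂ : W₂) (p q : ℤ) (r : ℂ),
    ∑ᶠ i : ℕ, ((-1 : ℂ) ^ i * (Ring.choose p i : ℂ)) •
        (A₃.Y v (p + q - i) (mode (r + i) w₁ w₂) -
          (-1 : ℂ) ^ p • mode (p + r - i) w₁ (A₂.Y v (q + i) w₂)) =
      ∑ᶠ i : ℕ, (Ring.choose q i : ℂ) • mode (q + r - i) (A₁.Y v (p + i) w₁) w₂
  derivative : ∀ (w₁ : W₁) (n : ℂ), mode n (A₁.L (-1) w₁) = (-n) • mode (n - 1) w₁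

section Triple

variable {ℓ : ℕ} {γ : OrthoBasis H ι} {W₁ W₂ W₃ : Type*} [AddCommGroup W₁] [Module ℂ W₁]
  [AddCommGroup W₂] [Module ℂ W₂] [AddCommGroup W₃] [Module ℂ W₃]
  (A₁ : LModule ℓ γ W₁) (A₂ : LModule ℓ γ W₂) (A₃ : LModule ℓ γ W₃)

/-- The space `T(W₁) ⊗ T(W₂) ⊗ T(W₃)`. -/
abbrev TopTensor : Type _ := (A₁.top ⊗[ℂ] A₂.top) ⊗[ℂ] A₃.top

/-- `Ω₁₂` is the adjoint of `∑ γᵢ ⊗ γᵢ ⊗ 1`. -/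
def Omega12 : Module.End ℂ (Module.Dual ℂ (TopTensor A₁ A₂ A₃)) :=
  ∑ i, (TensorProduct.map (TensorProduct.map (A₁.topAct (γ.toBasis i)) (A₂.topAct (γ.toBasis i)))
    LinearMap.id).dualMap

/-- `Ω₁₃` is the adjoint of `∑ γᵢ ⊗ 1 ⊗ γᵢ`. -/
def Omega13 : Module.End ℂ (Module.Dual ℂ (TopTensor A₁ A₂ A₃)) :=
  ∑ i, (TensorProduct.map (TensorProduct.map (A₁.topAct (γ.toBasis i)) LinearMap.id)
    (A₃.topAct (γ.toBasis i))).dualMap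

/-- `Ω₂₃` is the adjoint of `∑ 1 ⊗ γᵢ ⊗ γᵢ`. -/
def Omega23 : Module.End ℂ (Module.Dual ℂ (TopTensor A₁ A₂ A₃)) :=
  ∑ i, (TensorProduct.map (TensorProduct.map LinearMap.id (A₂.topAct (γ.toBasis i)))
    (A₃.topAct (γ.toBasis i))).dualMap

/-- `H̃ = (ℓ + h^∨)⁻¹ (Ω₁₂ + Ω₁₃ + Ω₂₃)`. -/
def Htilde : Module.End ℂ (Module.Dual ℂ (TopTensor A₁ A₂ A₃)) :=
  ((ℓ : ℂ) + dualCoxeter γ)⁻¹ • (Omega12 A₁ A₂ A₃ + Omega13 A₁ A₂ A₃ + Omega23 A₁ A₂ A₃)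

end Triple

end Modules

section Series

variable {E : Type*} [AddCommGroup E] [Module ℂ E]

variable (E) in
/-- Formal series `∑ F(s) x^s` over all complex exponents with coefficients in the dual of `E`. -/
abbrev Series₁ : Type _ := ℂ → Module.Dual ℂ E

variable (E) in
/-- Formal series `∑ S(s, t) x^s y^t` over all complex exponents with coefficients in the dual of
`E`. -/
abbrev Series₂ : Type _ := ℂ → ℂ → Module.Dual ℂ E

/-- The family `f` of functionals has the sum `s`: on each vector only finitely many members are
nonzero, and their values add up to that of `s`. -/
def PointwiseSum {κ : Type*} (f : κ → Module.Dual ℂ E) (s : Module.Dual ℂ E) : Prop :=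
  ∀ u : E, (Function.support fun i => f i u).Finite ∧ s u = ∑ᶠ i, f i u

/-- The partial derivative with respect to `x`. -/
def derivFst (S : Series₂ E) : Series₂ E := fun s t => (s + 1) • S (s + 1) t

/-- The partial derivative with respect to `y`. -/
def derivSnd (S : Series₂ E) : Series₂ E := fun s t => (t + 1) • S s (t + 1)

/-- Multiplication by `x⁻¹`. -/
def divFst (S : Series₂ E) : Series₂ E := fun s t => S (s + 1) t

/-- Multiplication by `y⁻¹`. -/
def divSnd (S : Series₂ E) : Series₂ E := fun s t => S s (t + 1)

/-- Application of an operator to all coefficients. -/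
def op₂ (A : Module.End ℂ (Module.Dual ℂ E)) (S : Series₂ E) : Series₂ E := fun s t => A (S s t)

/-- `R = (y + ε x)⁻¹ S`, where `(y + ε x)⁻¹ = ∑ (-ε)^i x^i y^(-1-i)` is expanded in nonnegative
powers of `x`; part of the claim is that the product exists. -/
def IsDivAdd (ε : ℂ) (S R : Series₂ E) : Prop :=
  ∀ s t : ℂ, PointwiseSum (fun i : ℕ => (-ε) ^ i • S (s - i) (t + 1 + i)) (R s t)

/-- `T(x, y) = S(x, y - x)`, where powers of `y - x` are expanded in nonnegative powers of `x`;
part of the claim is that the substitution is defined. -/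
def IsShift (S T : Series₂ E) : Prop :=
  ∀ s t : ℂ, PointwiseSum
    (fun i : ℕ => ((-1 : ℂ) ^ i * Ring.choose (t + i) i) • S (s - i) (t + i)) (T s t)

/-- The formal derivative. -/
def deriv₁ (F : Series₁ E) : Series₁ E := fun s => (s + 1) • F (s + 1)

/-- Multiplication by `x⁻¹`. -/
def div₁ (F : Series₁ E) : Series₁ E := fun s => F (s + 1)

/-- Application of an operator to all coefficients. -/
def op₁ (A : Module.End ℂ (Module.Dual ℂ E)) (F : Series₁ E) : Series₁ E := fun s => A (F s)

/-- `R = (1 - x)⁻¹ F`, with `(1 - x)⁻¹` expanded in nonnegative powers of `x`. -/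
def IsDivOneSub (F R : Series₁ E) : Prop :=
  ∀ s : ℂ, PointwiseSum (fun i : ℕ => F (s - i)) (R s)

/-- `P = y^A v`: the functional `v` is the sum of the coefficients `P n`, and `P n` is zero or an
eigenvector of `A` with eigenvalue `n`, on which `y^A` is `y^n`. -/
def IsPow (A : Module.End ℂ (Module.Dual ℂ E)) (v : Module.Dual ℂ E) (P : Series₁ E) : Prop :=
  (∀ n : ℂ, A (P n) = n • P n) ∧ PointwiseSum P v

/-- `S(x, y) = y^A F(x / y)`: the coefficient of `x^s` in `S` is `y^(-s) y^A F(s)`. -/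
def IsPowMulComp (A : Module.End ℂ (Module.Dual ℂ E)) (F : Series₁ E) (S : Series₂ E) : Prop :=
  ∀ s : ℂ, IsPow A (F s) fun n => S s (n - s)

end Series

section Correlators

variable {g : Type*} [LieRing g] [LieAlgebra ℂ g] [FiniteDimensional ℂ g]
  [LieAlgebra.IsSimple ℂ g] {H : LieSubalgebra ℂ g} [H.IsCartanSubalgebra]
  {ι : Type*} [Fintype ι] [DecidableEq ι] {ℓ : ℕ} {γ : OrthoBasis H ι}
  {W₁ W₂ W₃ W₄ N : Type*} [AddCommGroup W₁] [Module ℂ W₁]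
  [AddCommGroup W₂] [Module ℂ W₂] [AddCommGroup W₃] [Module ℂ W₃]
  [AddCommGroup W₄] [Module ℂ W₄] [AddCommGroup N] [Module ℂ N]
  {A₁ : LModule ℓ γ W₁} {A₂ : LModule ℓ γ W₂} {A₃ : LModule ℓ γ W₃} {A₄ : LModule ℓ γ W₄}
  {B : LModule ℓ γ N}

/-- The series `⟨f, 𝒴¹(𝒴²(·, x) ·, y) ·⟩` on `T(W₁) ⊗ T(W₂) ⊗ T(W₃)`, with `𝒴¹ = I` and `𝒴² = J`.
-/
def iterateSeries (f : Module.Dual ℂ W₄) (I : Intertwiner B A₃ A₄) (J : Intertwiner A₁ A₂ B) :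
    Series₂ (TopTensor A₁ A₂ A₃) := fun s t =>
  TensorProduct.lift <| TensorProduct.lift <| LinearMap.mk₂ ℂ
    (fun (u₁ : A₁.top) (u₂ : A₂.top) =>
      (f ∘ₗ I.mode (-t - 1) (J.mode (-s - 1) u₁ u₂)) ∘ₗ A₃.top.subtype)
    (fun _ _ _ => by ext; simp) (fun _ _ _ => by ext; simp)
    (fun _ _ _ => by ext; simp) (fun _ _ _ => by ext; simp)

/-- The series `⟨f, 𝒴₁(·, y) 𝒴₂(·, x) ·⟩` on `T(W₁) ⊗ T(W₂) ⊗ T(W₃)`, with `𝒴₁ = I` and `𝒴₂ = J`.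
-/
def productSeries (f : Module.Dual ℂ W₄) (I : Intertwiner A₁ B A₄) (J : Intertwiner A₂ A₃ B) :
    Series₂ (TopTensor A₁ A₂ A₃) := fun s t =>
  TensorProduct.lift <| TensorProduct.lift <| LinearMap.mk₂ ℂ
    (fun (u₁ : A₁.top) (u₂ : A₂.top) =>
      (f ∘ₗ I.mode (-t - 1) u₁ ∘ₗ J.mode (-s - 1) u₂) ∘ₗ A₃.top.subtype)
    (fun _ _ _ => by ext; simp) (fun _ _ _ => by ext; simp)
    (fun _ _ _ => by ext; simp) (fun _ _ _ => by ext; simp)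

theorem iterateSeries_apply (f : Module.Dual ℂ W₄) (I : Intertwiner B A₃ A₄)
    (J : Intertwiner A₁ A₂ B) (s t : ℂ) (u₁ : A₁.top) (u₂ : A₂.top) (u₃ : A₃.top) :
    iterateSeries f I J s t ((u₁ ⊗ₜ u₂) ⊗ₜ u₃) =
      f (I.mode (-t - 1) (J.mode (-s - 1) u₁ u₂) u₃) := rfl

theorem productSeries_apply (f : Module.Dual ℂ W₄) (I : Intertwiner A₁ B A₄)
    (J : Intertwiner A₂ A₃ B) (s t : ℂ) (u₁ : A₁.top) (u₂ : A₂.top) (u₃ : A₃.top) :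
    productSeries f I J s t ((u₁ ⊗ₜ u₂) ⊗ₜ u₃) =
      f (I.mode (-t - 1) u₁ (J.mode (-s - 1) u₂ u₃)) := rfl

end Correlators

end
end AffineKZ

namespace AffineKZ

noncomputable section

/-! The derivative axiom of an intertwining operator turns a derivative of the correlator into an
insertion of `L(-1)`, and the Sugawara formula (`LModule.L_neg_one`) writes `(ℓ + h^∨) L(-1)` as a
sum of products of current modes `γᵢ(m) γᵢ(n)`. Since `x(-1) 1` has conformal weight `1` and is
killed by `L(1)` (`virV_zero_cur`, `virV_one_cur`), positive current modes kill lowest-weight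
vectors (`LModule.mode_top`), and negative ones vanish when they stand leftmost under a functional
in `T(W₄')` (`LModule.topDual_mode`). The Jacobi identity moves the remaining negative modes onto
the other arguments. Only zero modes survive, with geometric series as coefficients: these are the
expansions of the inverse differences of positions, and the zero modes assemble into the `Ω`'s. This
proves `iterateSeries_system` and `productSeries_system`.

The rest is formal calculus with two facts about the correlators. Truncation of the inner
intertwining operator (`TruncFst`) makes every expansion and the substitution well defined. Weight
counting against a functional in the graded dual leaves finitely many total degrees on each vector
(`FinDegree`). The substitution `y ↦ y - x` obeys the chain rule and exchanges the singular factors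
(`IsShift.system`).

Finally, `x` times the `x`-equation plus `y` times the `y`-equation is an Euler equation: the part
of total degree `n` is an eigenvector of `H̃` with eigenvalue `n`. So the series is `y^H̃` applied
to its value at `y = 1` as a function of `x / y`, and the `x`-equation at `y = 1` is the ordinary
differential equation (`exists_isPowMulComp_of_system`). -/

theorem nontrivial_of_isSimple (g : Type*) [LieRing g] [LieAlgebra ℂ g]
    [LieAlgebra.IsSimple ℂ g] : Nontrivial g := by
  by_contra h
  rw [not_nontrivial_iff_subsingleton] at h
  exact LieAlgebra.IsSimple.non_abelian (R := ℂ) (L := g) ⟨fun x y => Subsingleton.elim _ _⟩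

/-! ### The Casimir operator on the adjoint representation and the dual Coxeter number -/

section LieData

variable {g : Type*} [LieRing g] [LieAlgebra ℂ g] [FiniteDimensional ℂ g]
  [LieAlgebra.IsSimple ℂ g] {H : LieSubalgebra ℂ g} [H.IsCartanSubalgebra]
  {ι : Type*} [Fintype ι] [DecidableEq ι]

/-- The Casimir operator on the adjoint representation. -/
def adCasimir (γ : OrthoBasis H ι) : Module.End ℂ g :=
  ∑ i, LieAlgebra.ad ℂ g (γ.toBasis i) ∘ₗ LieAlgebra.ad ℂ g (γ.toBasis i)

theorem adCasimir_apply (γ : OrthoBasis H ι) (y : g) :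
    adCasimir γ y = ∑ i, ⁅γ.toBasis i, ⁅γ.toBasis i, y⁆⁆ := by
  simp [adCasimir, LinearMap.sum_apply]

/-- This is invariance of the Casimir tensor, tested on the bilinear map `(a, b) ↦ ad a ∘ ad b`. -/
theorem adCasimir_lie (γ : OrthoBasis H ι) (x y : g) :
    adCasimir γ ⁅x, y⁆ = ⁅x, adCasimir γ y⁆ := by
  have h := casimir_invariant γ
    ((LinearMap.mul ℂ (Module.End ℂ g)).compl₁₂ (LieAlgebra.ad ℂ g : g →ₗ[ℂ] Module.End ℂ g)
      (LieAlgebra.ad ℂ g : g →ₗ[ℂ] Module.End ℂ g)) x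
  have h' := congrArg (fun e : Module.End ℂ g => e y) h
  simp only [LinearMap.compl₁₂_apply, LinearMap.mul_apply', LinearMap.sum_apply,
    LinearMap.add_apply, Module.End.mul_apply, LieHom.coe_toLinearMap, LieAlgebra.ad_apply,
    LinearMap.zero_apply] at h'
  rw [adCasimir_apply, adCasimir_apply, lie_sum, eq_comm, ← sub_eq_zero,
    ← Finset.sum_sub_distrib, ← h']
  refine Finset.sum_congr rfl fun i _ => ?_
  rw [leibniz_lie x (γ.toBasis i) ⁅γ.toBasis i, y⁆, leibniz_lie x (γ.toBasis i) y, lie_add]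
  abel

/-- Schur's lemma: an eigenspace of an operator commuting with `ad` is a nonzero ideal, hence
everything. The scalar is then read off from the trace by which `dualCoxeter` is defined. -/
theorem adCasimir_eq_smul (γ : OrthoBasis H ι) (x : g) :
    adCasimir γ x = (2 * dualCoxeter γ) • x := by
  have : Nontrivial g := nontrivial_of_isSimple g
  obtain ⟨μ, hμ⟩ := Module.End.exists_eigenvalue (adCasimir γ)
  let I : LieIdeal ℂ g :=
    { Module.End.eigenspace (adCasimir γ) μ with
      lie_mem := fun {x m} hm => by
        have hm' : adCasimir γ m = μ • m := Module.End.mem_eigenspace_iff.mp hm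
        refine Module.End.mem_eigenspace_iff.mpr ?_
        rw [adCasimir_lie, hm', lie_smul] }
  have hI : I = ⊤ := by
    refine (LieAlgebra.IsSimple.eq_bot_or_eq_top I).resolve_left fun h => ?_
    obtain ⟨v, hv, hv0⟩ := hμ.exists_hasEigenvector
    have : v ∈ I := hv
    rw [h] at this
    exact hv0 (by simpa using this)
  have hC : ∀ y, adCasimir γ y = μ • y := fun y => by
    have : y ∈ I := by rw [hI]; trivial
    exact Module.End.mem_eigenspace_iff.mp this
  have hC' : adCasimir γ = μ • LinearMap.id := LinearMap.ext hC
  have hn : (Module.finrank ℂ g : ℂ) ≠ 0 := by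
    exact_mod_cast (Module.finrank_pos (R := ℂ) (M := g)).ne'
  have hd : dualCoxeter γ = μ / 2 := by
    have : LinearMap.trace ℂ g (adCasimir γ) = μ * Module.finrank ℂ g := by
      rw [hC', map_smul, LinearMap.trace_id, smul_eq_mul]
    rw [dualCoxeter]
    rw [adCasimir] at this
    rw [this]
    field_simp
  rw [hC, hd]
  congr 1
  ring

/-- If the normalized form is `r / 2` times the Killing form, then orthonormality gives `tr (ad γᵢ)²
= 2 / r`, so `h^∨ = 1 / r`, a positive real number. Without this, the factor `(ℓ + h^∨)⁻¹` in `ω`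
and in `H̃` could be the default value `0`. -/
theorem level_add_dualCoxeter_ne_zero (γ : OrthoBasis H ι) (ℓ : ℕ) :
    (ℓ : ℂ) + dualCoxeter γ ≠ 0 := by
  have : Nontrivial g := nontrivial_of_isSimple g
  have : Nonempty ι := γ.toBasis.index_nonempty
  -- The only property of root lengths used is that `r`, a supremum of norms, is real and
  -- nonnegative; that it is nonzero follows from the existence of an orthonormal basis.
  obtain ⟨r, hr, hr0⟩ : ∃ r : ℝ, normalizedForm H = ((r : ℂ) / 2) • killingForm ℂ g ∧ 0 ≤ r :=
    ⟨_, rfl, Real.iSup_nonneg fun _ => norm_nonneg _⟩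
  have hγ : ∀ i, (r : ℂ) / 2 * killingForm ℂ g (γ.toBasis i) (γ.toBasis i) = 1 := fun i => by
    have := γ.orthonormal i i
    rwa [if_pos rfl, hr] at this
  have hr1 : (r : ℂ) ≠ 0 := fun h => by
    have := hγ (Classical.arbitrary ι)
    simp [h] at this
  have hK : ∀ i, killingForm ℂ g (γ.toBasis i) (γ.toBasis i) = 2 / r := fun i => by
    rw [eq_div_iff hr1]
    linear_combination 2 * hγ i
  have ht : LinearMap.trace ℂ g (∑ i, LieAlgebra.ad ℂ g (γ.toBasis i) ∘ₗ
      LieAlgebra.ad ℂ g (γ.toBasis i)) = Fintype.card ι * (2 / r) := by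
    rw [map_sum]
    have : ∀ i, LinearMap.trace ℂ g (LieAlgebra.ad ℂ g (γ.toBasis i) ∘ₗ
        LieAlgebra.ad ℂ g (γ.toBasis i)) = 2 / r := fun i => by
      rw [← hK i]
      rfl
    simp [this]
  have hd : dualCoxeter γ = ((r⁻¹ : ℝ) : ℂ) := by
    rw [dualCoxeter, ht, Module.finrank_eq_card_basis γ.toBasis]
    have : (Fintype.card ι : ℂ) ≠ 0 := by exact_mod_cast Fintype.card_ne_zero
    push_cast
    field_simp
  have hpos : 0 < r := lt_of_le_of_ne hr0 fun h => hr1 (by rw [← h]; simp)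
  have : (0 : ℝ) < ℓ + r⁻¹ := by positivity
  rw [hd]
  exact_mod_cast this.ne'

end LieData

/-! ### The vectors `x(-1) 1` under `L(0)` and `L(1)` -/

section Vacuum

variable {g : Type*} [LieRing g] [LieAlgebra ℂ g] [FiniteDimensional ℂ g]
  [LieAlgebra.IsSimple ℂ g] {H : LieSubalgebra ℂ g} [H.IsCartanSubalgebra]
  {ι : Type*} [Fintype ι] [DecidableEq ι]

theorem central_vac (ℓ : ℕ) :
    UniversalEnvelopingAlgebra.ι ℂ (central H) • vac H ℓ = (ℓ : ℂ) • vac H ℓ := by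
  have h : (vacuumIdeal H ℓ).mkQ (UniversalEnvelopingAlgebra.ι ℂ (central H) -
      algebraMap ℂ (AffineU H) (ℓ : ℂ)) = 0 :=
    (Submodule.Quotient.mk_eq_zero _).mpr (Submodule.subset_span (Or.inr rfl))
  have h' : LVac.mk H ℓ (UniversalEnvelopingAlgebra.ι ℂ (central H) -
      algebraMap ℂ (AffineU H) (ℓ : ℂ)) = 0 :=
    (congrArg (maxSubmodule H ℓ).mkQ h).trans (map_zero _)
  rw [map_sub, sub_eq_zero] at h'
  have e : ∀ a : AffineU H, a • vac H ℓ = LVac.mk H ℓ a := fun a => by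
    rw [vac, ← map_smul, smul_eq_mul, mul_one]
  rw [e, h', ← e, algebraMap_smul]

variable (H) in
/-- The vector `x(-1) 1` of `L(ℓ, 0)`. -/
def cur (ℓ : ℕ) (x : g) : LVac H ℓ := act H ℓ (-1) x (vac H ℓ)

theorem act_cur (ℓ : ℕ) (n : ℤ) (hn : 0 ≤ n) (x y : g) :
    act H ℓ n x (cur H ℓ y) = act H ℓ (n - 1) ⁅x, y⁆ (vac H ℓ) +
      (if n = 1 then normalizedForm H x y * ℓ else 0) • vac H ℓ := by
  rw [cur, act_comm, act_vac H ℓ n hn, map_zero, zero_add, central_vac, smul_smul]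
  congr 2
  by_cases h : n = 1
  · subst h; simp
  · rw [if_neg (by omega), if_neg h, zero_mul]

theorem virV_apply (ℓ : ℕ) (γ : OrthoBasis H ι) (n : ℤ) (w : LVac H ℓ) :
    virV ℓ γ n w = (2 * ((ℓ : ℂ) + dualCoxeter γ))⁻¹ • ∑ i, ∑ᶠ j : ℕ,
      prodTerm (-1) (fun m => act H ℓ m (γ.toBasis i)) (fun m => act H ℓ m (γ.toBasis i))
        (n + 1) w j := by
  simp only [virV, omegaField, Submodule.coe_smul, Pi.smul_apply, LinearMap.smul_apply,
    AddSubmonoidClass.coe_finsetSum, Finset.sum_apply, LinearMap.sum_apply, nthProd_apply]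
  rfl

theorem neg_one_pow_mul_choose_neg_one (i : ℕ) :
    (-1 : ℂ) ^ i * Ring.choose ((-1 : ℤ) : ℂ) i = 1 := by
  rw [Int.cast_neg, Int.cast_one, Ring.choose_neg, add_sub_cancel_left, Ring.choose_natCast]
  simp only [Nat.choose_self, Nat.cast_one, Int.negOnePow_def, zpow_natCast, Units.smul_def]
  push_cast
  rw [zsmul_one]
  push_cast
  rw [← mul_pow]
  simp

theorem prodTerm_neg_one {M : Type*} [AddCommGroup M] [Module ℂ M]
    (a b : ℤ → Module.End ℂ M) (m : ℤ) (w : M) (i : ℕ) :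
    prodTerm (-1) a b m w i = a (-1 - i) (b (m + i) w) + b (-1 + m - i) (a i w) := by
  rw [prodTerm, neg_one_pow_mul_choose_neg_one, one_smul]
  simp

/-- The conditions defining lowest-weight vectors speak of homogeneous `v`, so this is what makes
them apply to currents. In the normally ordered sum only `2 γᵢ(-1) γᵢ(1) + γᵢ(0)²` acts
nontrivially. The first part gives `2ℓ` through the central term, the second gives the Casimir
scalar `2 h^∨`, and the total cancels the normalization of `ω`. -/
theorem virV_zero_cur (ℓ : ℕ) (γ : OrthoBasis H ι) (x : g) :
    virV ℓ γ 0 (cur H ℓ x) = cur H ℓ x := by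
  have h : ∀ i, ∑ᶠ j : ℕ, prodTerm (-1) (fun m => act H ℓ m (γ.toBasis i))
      (fun m => act H ℓ m (γ.toBasis i)) (0 + 1) (cur H ℓ x) j =
      (2 * ℓ * normalizedForm H x (γ.toBasis i)) • cur H ℓ (γ.toBasis i) +
        cur H ℓ ⁅γ.toBasis i, ⁅γ.toBasis i, x⁆⁆ := by
    intro i
    rw [finsum_eq_sum_of_support_subset (s := Finset.range 2)]
    · have h0 (y : g) : act H ℓ 0 (γ.toBasis i) (cur H ℓ y) = cur H ℓ ⁅γ.toBasis i, y⁆ := by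
        rw [act_cur _ _ le_rfl, if_neg (by norm_num), zero_smul, add_zero, zero_sub, cur]
      have h1 : act H ℓ 1 (γ.toBasis i) (cur H ℓ x) =
          (normalizedForm H x (γ.toBasis i) * ℓ) • vac H ℓ := by
        rw [act_cur _ _ (by norm_num), if_pos rfl, act_vac _ _ _ (by norm_num), zero_add,
          normalizedForm_symm H x]
      have h2 : act H ℓ 2 (γ.toBasis i) (cur H ℓ x) = 0 := by
        rw [act_cur _ _ (by norm_num), if_neg (by norm_num), act_vac _ _ _ (by norm_num),
          zero_smul, zero_add]
      have h3 (y : g) : act H ℓ (-1) y (vac H ℓ) = cur H ℓ y := rfl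
      simp only [prodTerm_neg_one, Finset.sum_range_succ, Finset.sum_range_zero, Nat.cast_zero,
        Nat.cast_one, Int.add_zero, Int.zero_add, Int.sub_zero,
        Int.add_left_neg, Int.reduceAdd, Int.reduceNeg, Int.reduceSub, h0, h1, h2, map_zero,
        map_smul, h3]
      module
    · intro j hj
      by_contra hj2
      have : 2 ≤ j := not_lt.mp fun h => hj2 (Finset.mem_coe.mpr (Finset.mem_range.mpr h))
      refine hj ?_
      rw [prodTerm_neg_one, act_cur _ _ (by omega), act_cur _ _ (by omega), if_neg (by omega),
        if_neg (by omega), act_vac _ _ _ (by omega), act_vac _ _ _ (by omega)]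
      simp
  have hrep : ∑ i, normalizedForm H x (γ.toBasis i) • cur H ℓ (γ.toBasis i) = cur H ℓ x := by
    have h : ∀ j, normalizedForm H x (γ.toBasis j) = γ.toBasis.repr x j := by
      intro j
      conv_lhs => rw [← γ.toBasis.sum_repr x]
      simp only [map_sum, map_smul, LinearMap.sum_apply, LinearMap.smul_apply, γ.orthonormal]
      simp
    simp_rw [h]
    conv_rhs => rw [cur, ← γ.toBasis.sum_repr x]
    rw [map_sum, LinearMap.sum_apply]
    simp only [map_smul, LinearMap.smul_apply, cur]
  have hcas : ∑ i, cur H ℓ ⁅γ.toBasis i, ⁅γ.toBasis i, x⁆⁆ = (2 * dualCoxeter γ) • cur H ℓ x := by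
    have := congrArg (cur H ℓ) ((adCasimir_apply γ x).symm.trans (adCasimir_eq_smul γ x))
    simpa [cur] using this
  rw [virV_apply]
  simp_rw [h]
  rw [Finset.sum_add_distrib, hcas]
  simp_rw [mul_smul _ (normalizedForm H x _)]
  rw [← Finset.smul_sum, hrep, ← add_smul, smul_smul]
  have := level_add_dualCoxeter_ne_zero γ ℓ
  rw [show (2 : ℂ) * ℓ + 2 * dualCoxeter γ = 2 * (ℓ + dualCoxeter γ) by ring,
    inv_mul_cancel₀ (by simpa using this), one_smul]

/-- This removes the factor `e^(z L(1))` from contragredient current modes. The one term that might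
survive is `γᵢ(1) γᵢ(0)`, and it yields `⟨γᵢ, [γᵢ, x]⟩ = 0`. -/
theorem virV_one_cur (ℓ : ℕ) (γ : OrthoBasis H ι) (x : g) :
    virV ℓ γ 1 (cur H ℓ x) = 0 := by
  rw [virV_apply, Finset.sum_eq_zero, smul_zero]
  intro i _
  refine finsum_eq_zero_of_forall_eq_zero fun j => ?_
  have h0 : normalizedForm H (γ.toBasis i) ⁅γ.toBasis i, x⁆ = 0 := by
    have := normalizedForm_inv H (γ.toBasis i) (γ.toBasis i) x
    rw [lie_self, map_zero, LinearMap.zero_apply] at this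
    exact neg_eq_zero.mp this.symm
  rw [prodTerm_neg_one, act_cur _ _ (by omega), if_neg (by omega), act_vac _ _ _ (by omega), zero_smul,
    add_zero, map_zero, zero_add, act_cur _ _ (by omega)]
  rcases Nat.eq_zero_or_pos j with rfl | hj
  · rw [if_neg (by norm_num), zero_smul, add_zero]
    have : act H ℓ (((0 : ℕ) : ℤ) - 1) ⁅γ.toBasis i, x⁆ (vac H ℓ) = cur H ℓ ⁅γ.toBasis i, x⁆ := rfl
    rw [this, act_cur _ _ (by norm_num), act_vac _ _ _ (by norm_num), h0]
    simp
  · rw [act_vac _ _ _ (by omega), zero_add, map_smul]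
    by_cases hj1 : j = 1
    · subst hj1
      rw [act_vac _ _ _ (by norm_num), smul_zero]
    · rw [if_neg (by omega), zero_smul]

end Vacuum

/-! ### Formal calculus: division, substitution and homogeneity -/

section Series

variable {E : Type*} [AddCommGroup E] [Module ℂ E]

namespace PointwiseSum

variable {κ : Type*} {f f' : κ → Module.Dual ℂ E} {s s' : Module.Dual ℂ E}

theorem unique (h : PointwiseSum f s) (h' : PointwiseSum f s') : s = s' :=
  LinearMap.ext fun u => (h u).2.trans (h' u).2.symm

theorem exists_of_finite (hf : ∀ u, (Function.support fun i => f i u).Finite) :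
    ∃ s, PointwiseSum f s :=
  ⟨{ toFun := fun u => ∑ᶠ i, f i u
     map_add' := fun u v => by
       rw [← finsum_add_distrib (hf u) (hf v)]
       exact finsum_congr fun i => map_add _ _ _
     map_smul' := fun c u => by
       rw [RingHom.id_apply, smul_finsum' c (hf u)]
       exact finsum_congr fun i => map_smul _ _ _ }, fun u => ⟨hf u, rfl⟩⟩

theorem add (h : PointwiseSum f s) (h' : PointwiseSum f' s') :
    PointwiseSum (fun i => f i + f' i) (s + s') := fun u => by
  refine ⟨((h u).1.union (h' u).1).subset (Function.support_add _ _), ?_⟩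
  rw [LinearMap.add_apply, (h u).2, (h' u).2, ← finsum_add_distrib (h u).1 (h' u).1]
  rfl

theorem smul (c : ℂ) (h : PointwiseSum f s) : PointwiseSum (fun i => c • f i) (c • s) := fun u => by
  refine ⟨(h u).1.subset (Function.support_const_smul_subset c _), ?_⟩
  rw [LinearMap.smul_apply, (h u).2, smul_finsum' c (h u).1]
  rfl

theorem dualMap (a : Module.End ℂ E) (h : PointwiseSum f s) :
    PointwiseSum (fun i => a.dualMap (f i)) (a.dualMap s) := fun u => h (a u)

theorem apply_eq_sum (h : PointwiseSum f s) {u : E} {K : Finset κ} (hK : ∀ i ∉ K, f i u = 0) :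
    s u = ∑ i ∈ K, f i u := by
  rw [(h u).2]
  refine finsum_eq_sum_of_support_subset _ fun i hi => ?_
  by_contra h'
  exact hi (hK i h')

theorem apply_eq_sum_range {f : ℕ → Module.Dual ℂ E} (h : PointwiseSum f s) {u : E} {N : ℕ}
    (hN : ∀ i, N ≤ i → f i u = 0) : s u = ∑ i ∈ Finset.range N, f i u :=
  h.apply_eq_sum fun i hi => hN i (by simpa using hi)

theorem exists_of_bounded {f : ℕ → Module.Dual ℂ E}
    (hf : ∀ u, ∃ N : ℕ, ∀ i, N ≤ i → f i u = 0) : ∃ s, PointwiseSum f s := by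
  refine exists_of_finite fun u => ?_
  obtain ⟨N, hN⟩ := hf u
  refine (Set.finite_Iio N).subset fun i hi => ?_
  by_contra h
  exact hi (hN i (not_lt.mp h))

theorem of_eq_sum_range {f : ℕ → Module.Dual ℂ E}
    (hf : ∀ u, ∃ N : ℕ, (∀ i, N ≤ i → f i u = 0) ∧ s u = ∑ i ∈ Finset.range N, f i u) :
    PointwiseSum f s := by
  obtain ⟨s', hs'⟩ := exists_of_bounded fun u => (hf u).imp fun N h => h.1
  convert hs'
  refine LinearMap.ext fun u => ?_
  obtain ⟨N, hN, h⟩ := hf u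
  rw [h, hs'.apply_eq_sum_range hN]

end PointwiseSum

/-- On each vector, the exponents of `x` in each class modulo `ℤ` are bounded below, uniformly in
the exponent of `y`. -/
def TruncFst (S : Series₂ E) : Prop :=
  ∀ (u : E) (s : ℂ), ∃ N : ℕ, ∀ i : ℕ, N ≤ i → ∀ t, S (s - i) t u = 0

/-- On each vector, only finitely many total degrees occur. -/
def FinDegree (S : Series₂ E) : Prop :=
  ∀ u : E, ∃ K : Finset ℂ, ∀ s t, S s t u ≠ 0 → s + t ∈ K

theorem eq_of_args_eq {S : Series₂ E} {s t s' t' : ℂ} (hs : s = s') (ht : t = t') :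
    S s t = S s' t' := by rw [hs, ht]

theorem TruncFst.divFst {S : Series₂ E} (h : TruncFst S) : TruncFst (divFst S) := fun u s => by
  obtain ⟨N, hN⟩ := h u (s + 1)
  refine ⟨N, fun i hi t => ?_⟩
  rw [AffineKZ.divFst, show s - i + 1 = s + 1 - i by ring, hN i hi]

theorem TruncFst.divSnd {S : Series₂ E} (h : TruncFst S) : TruncFst (divSnd S) := fun u s =>
  (h u s).imp fun _ hN i hi t => hN i hi (t + 1)

theorem TruncFst.derivFst {S : Series₂ E} (h : TruncFst S) : TruncFst (derivFst S) := fun u s =>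
  (h.divFst u s).imp fun _ hN i hi t => by
    have := hN i hi t
    rw [AffineKZ.divFst] at this
    rw [AffineKZ.derivFst, LinearMap.smul_apply, this, smul_zero]

/-- Division by `y + ε x` and the substitution `y ↦ y - x` both have this shape. The truncation
bound must be uniform in the exponent of `y`, because that exponent moves with `i`. -/
theorem TruncFst.of_pointwiseSum {S T : Series₂ E} (h : TruncFst S) {c : ℂ → ℂ → ℕ → ℂ}
    {τ : ℂ → ℕ → ℂ}
    (hT : ∀ s t, PointwiseSum (fun i : ℕ => c s t i • S (s - i) (τ t i)) (T s t)) :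
    TruncFst T := fun u s => by
  obtain ⟨N, hN⟩ := h u s
  refine ⟨N, fun i hi t => ?_⟩
  rw [(hT (s - i) t).apply_eq_sum_range (N := 0), Finset.range_zero, Finset.sum_empty]
  intro j _
  rw [LinearMap.smul_apply, show s - i - j = s - ((i + j : ℕ) : ℂ) by push_cast; ring,
    hN _ (by omega), smul_zero]

theorem TruncFst.exists_pointwiseSum {S : Series₂ E} (h : TruncFst S) (c : ℂ → ℂ → ℕ → ℂ)
    (τ : ℂ → ℕ → ℂ) :
    ∃ T : Series₂ E, ∀ s t, PointwiseSum (fun i : ℕ => c s t i • S (s - i) (τ t i)) (T s t) := by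
  have key : ∀ s t, ∃ T, PointwiseSum (fun i : ℕ => c s t i • S (s - i) (τ t i)) T := fun s t =>
    PointwiseSum.exists_of_bounded fun u => (h u s).imp fun N hN i hi => by
      rw [LinearMap.smul_apply, hN i hi, smul_zero]
  choose T hT using key
  exact ⟨T, hT⟩

theorem exists_isDivAdd {S : Series₂ E} (h : TruncFst S) (ε : ℂ) : ∃ R, IsDivAdd ε S R :=
  h.exists_pointwiseSum (fun _ _ i => (-ε) ^ i) fun t i => t + 1 + i

theorem IsDivAdd.truncFst {S R : Series₂ E} {ε : ℂ} (h : TruncFst S) (hR : IsDivAdd ε S R) :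
    TruncFst R :=
  h.of_pointwiseSum (c := fun _ _ i => (-ε) ^ i) (τ := fun t i => t + 1 + i) hR

theorem exists_isShift {S : Series₂ E} (h : TruncFst S) : ∃ T, IsShift S T :=
  h.exists_pointwiseSum (fun _ t i => (-1 : ℂ) ^ i * Ring.choose (t + i) i) fun t i => t + i

theorem IsShift.truncFst {S T : Series₂ E} (h : TruncFst S) (hT : IsShift S T) : TruncFst T :=
  h.of_pointwiseSum (c := fun _ t i => (-1 : ℂ) ^ i * Ring.choose (t + i) i)
    (τ := fun t i => t + i) hT

theorem IsShift.finDegree {S T : Series₂ E} (h : FinDegree S) (hT : IsShift S T) :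
    FinDegree T := fun u => by
  obtain ⟨K, hK⟩ := h u
  refine ⟨K, fun s t => ?_⟩
  contrapose!
  intro hst
  rw [(hT s t).apply_eq_sum_range (N := 0), Finset.range_zero, Finset.sum_empty]
  intro i _
  have : S (s - i) (t + i) u = 0 := by
    by_contra h0
    have := hK _ _ h0
    rw [show s - i + (t + i) = s + t by ring] at this
    exact hst this
  rw [LinearMap.smul_apply, this, smul_zero]

/-- `(y + ε x) R = S` if `R = (y + ε x)⁻¹ S`. -/
theorem IsDivAdd.mul_eq {S R : Series₂ E} {ε : ℂ} (h : TruncFst S) (hR : IsDivAdd ε S R)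
    (s t : ℂ) : R s (t - 1) + ε • R (s - 1) t = S s t := by
  refine LinearMap.ext fun u => ?_
  -- Truncating at `s - 1` gives `N` terms there and `N + 1` terms at `s`; all but the leading one
  -- of the latter cancel against the former.
  obtain ⟨N, hN⟩ := h u (s - 1)
  have h1 := (hR (s - 1) t).apply_eq_sum_range (u := u) (N := N) fun i hi => by
    rw [LinearMap.smul_apply, hN i hi, smul_zero]
  have h2 := (hR s (t - 1)).apply_eq_sum_range (u := u) (N := N + 1) fun i hi => by
    obtain ⟨j, rfl⟩ : ∃ j, i = j + 1 := ⟨i - 1, by omega⟩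
    rw [LinearMap.smul_apply, show s - ((j + 1 : ℕ) : ℂ) = s - 1 - j by push_cast; ring,
      hN j (by omega), smul_zero]
  rw [LinearMap.add_apply, LinearMap.smul_apply, h1, h2, Finset.sum_range_succ', Finset.smul_sum,
    add_right_comm, ← Finset.sum_add_distrib, Finset.sum_eq_zero, zero_add]
  · simp
  · intro i _
    rw [LinearMap.smul_apply, LinearMap.smul_apply,
      eq_of_args_eq (S := S) (show s - ((i + 1 : ℕ) : ℂ) = s - 1 - i by push_cast; ring)
        (show t - 1 + 1 + ((i + 1 : ℕ) : ℂ) = t + 1 + i by push_cast; ring), smul_smul,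
      ← add_smul]
    rw [show (-ε) ^ (i + 1) + ε * (-ε) ^ i = 0 by ring, zero_smul]

/-- A truncated series is determined by its product with `y + ε x`: solving for `R s t` and
iterating produces the geometric expansion, and truncation eventually kills the remainder. -/
theorem isDivAdd_of_mul_eq {S R : Series₂ E} {ε : ℂ} (hR : TruncFst R)
    (h : ∀ s t, R s (t - 1) + ε • R (s - 1) t = S s t) : IsDivAdd ε S R := fun s t => by
  refine PointwiseSum.of_eq_sum_range fun u => ?_
  obtain ⟨N, hN⟩ := hR u s
  refine ⟨N, fun i hi => ?_, ?_⟩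
  · rw [← h, LinearMap.smul_apply, LinearMap.add_apply, LinearMap.smul_apply, hN i hi,
      show s - i - 1 = s - ((i + 1 : ℕ) : ℂ) by push_cast; ring, hN (i + 1) (by omega)]
    simp
  · have key : ∀ M : ℕ, R s t u = ∑ i ∈ Finset.range M, ((-ε) ^ i • S (s - i) (t + 1 + i)) u +
        (-ε) ^ M • R (s - M) (t + M) u := by
      intro M
      induction M with
      | zero => simp
      | succ M ih =>
        rw [ih, Finset.sum_range_succ, ← h, LinearMap.smul_apply, LinearMap.add_apply,
          LinearMap.smul_apply,
          eq_of_args_eq (S := R) (show s - ((M + 1 : ℕ) : ℂ) = s - M - 1 by push_cast; ring)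
            (show t + ((M + 1 : ℕ) : ℂ) = t + 1 + M by push_cast; ring),
          eq_of_args_eq (S := R) (rfl : s - (M : ℂ) = s - M)
            (show t + 1 + (M : ℂ) - 1 = t + M by ring), pow_succ]
        simp only [smul_eq_mul]
        ring
    rw [key N, hN N le_rfl, smul_zero, add_zero]

theorem IsShift.add {S T S' T' : Series₂ E} (h : IsShift S T) (h' : IsShift S' T') :
    IsShift (S + S') (T + T') := fun s t => by
  convert (h s t).add (h' s t) using 2 with i
  · rw [Pi.add_apply, Pi.add_apply, smul_add]
  · rfl

theorem IsShift.smul {S T : Series₂ E} (c : ℂ) (h : IsShift S T) :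
    IsShift (c • S) (c • T) := fun s t => by
  convert (h s t).smul c using 2 with i
  · rw [Pi.smul_apply, Pi.smul_apply, smul_comm]
  · rfl

theorem IsShift.op₂ {S T : Series₂ E} (a : Module.End ℂ E) (h : IsShift S T) :
    IsShift (op₂ a.dualMap S) (op₂ a.dualMap T) := fun s t => by
  convert (h s t).dualMap a using 2 with i
  · rw [AffineKZ.op₂, map_smul]
  · rfl

theorem IsShift.unique {S T T' : Series₂ E} (h : IsShift S T) (h' : IsShift S T') : T = T' :=
  funext fun s => funext fun t => (h s t).unique (h' s t)

theorem IsShift.divFst {S T : Series₂ E} (h : IsShift S T) :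
    IsShift (divFst S) (divFst T) := fun s t => by
  convert h (s + 1) t using 2 with i
  · rw [AffineKZ.divFst]
    congr 2
    ring
  · rfl

theorem succ_mul_choose_succ (r : ℂ) (k : ℕ) :
    ((k : ℂ) + 1) * Ring.choose (r + 1) (k + 1) = (r + 1) * Ring.choose r k := by
  have := Ring.choose_smul_choose (r + 1) (n := k + 1) (k := 1) (by omega)
  simpa using this

theorem choose_succ_mul_sub (r : ℂ) (k : ℕ) :
    Ring.choose (r + 1) k * (r + 1 - k) = (r + 1) * Ring.choose r k := by
  have := Ring.choose_smul_choose (r + 1) (n := k + 1) (k := k) (by omega)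
  rw [← succ_mul_choose_succ]
  simpa using this.symm

/-- The substitution turns multiplication by `y` into multiplication by `y - x`. -/
theorem IsShift.mul_snd {S T Q : Series₂ E} (hS : TruncFst S) (h : IsShift S T)
    (h' : IsShift (AffineKZ.divSnd S) Q) (s t : ℂ) : Q s (t - 1) - Q (s - 1) t = T s t := by
  refine LinearMap.ext fun u => ?_
  obtain ⟨N, hN⟩ := hS u (s - 1)
  have hN' : ∀ i, N + 1 ≤ i → ∀ t, S (s - i) t u = 0 := fun i hi t => by
    obtain ⟨j, rfl⟩ : ∃ j, i = j + 1 := ⟨i - 1, by omega⟩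
    rw [show s - ((j + 1 : ℕ) : ℂ) = s - 1 - j by push_cast; ring, hN j (by omega)]
  have h0 := (h s t).apply_eq_sum_range (u := u) (N := N + 1) fun i hi => by
    rw [LinearMap.smul_apply, hN' i hi, smul_zero]
  have h1 := (h' (s - 1) t).apply_eq_sum_range (u := u) (N := N) fun i hi => by
    rw [LinearMap.smul_apply, AffineKZ.divSnd, hN i hi, smul_zero]
  have h2 := (h' s (t - 1)).apply_eq_sum_range (u := u) (N := N + 1) fun i hi => by
    rw [LinearMap.smul_apply, AffineKZ.divSnd, hN' i hi, smul_zero]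
  rw [LinearMap.sub_apply, h0, h1, h2, Finset.sum_range_succ', Finset.sum_range_succ',
    add_sub_right_comm, ← Finset.sum_sub_distrib]
  congr 1
  · refine Finset.sum_congr rfl fun i _ => ?_
    simp only [LinearMap.smul_apply, AffineKZ.divSnd]
    rw [eq_of_args_eq (S := S) (show s - ((i + 1 : ℕ) : ℂ) = s - 1 - i by push_cast; ring)
        (show t - 1 + ((i + 1 : ℕ) : ℂ) + 1 = t + i + 1 by push_cast; ring),
      eq_of_args_eq (S := S) (show s - ((i + 1 : ℕ) : ℂ) = s - 1 - i by push_cast; ring)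
        (show t + ((i + 1 : ℕ) : ℂ) = t + i + 1 by push_cast; ring),
      show t - 1 + ((i + 1 : ℕ) : ℂ) = t + i by push_cast; ring,
      -- Coefficientwise, the claim is Pascal's rule for `Ring.choose (t + i + 1) (i + 1)`.
      show t + ((i + 1 : ℕ) : ℂ) = t + i + 1 by push_cast; ring, Ring.choose_succ_succ, pow_succ]
    simp only [smul_eq_mul]
    ring
  · simp [AffineKZ.divSnd]

/-- The substituted quantity `y - x` has `y`-derivative `1`, so the two operations commute. -/
theorem IsShift.derivSnd {S T : Series₂ E} (h : IsShift S T) :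
    IsShift (derivSnd S) (derivSnd T) := fun s t => by
  convert (h s (t + 1)).smul (t + 1) using 2 with i
  · rw [AffineKZ.derivSnd, smul_smul, smul_smul,
      eq_of_args_eq (S := S) (rfl : s - (i : ℂ) = s - i) (show t + i + 1 = t + 1 + i by ring)]
    congr 1
    have := choose_succ_mul_sub (t + i) i
    rw [show t + 1 + (i : ℂ) = t + i + 1 by ring]
    linear_combination -(-1) ^ i * this
  · rfl

/-- The chain rule: `x` also enters through `y - x`, which contributes minus the substituted
`y`-derivative, and by `IsShift.derivSnd` that is the `y`-derivative of `T`. -/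
theorem IsShift.derivFst {S T : Series₂ E} (hS : TruncFst S) (h : IsShift S T) {P : Series₂ E}
    (hP : IsShift (AffineKZ.derivFst S) P) :
    AffineKZ.derivFst T = P - AffineKZ.derivSnd T := by
  funext s t
  refine LinearMap.ext fun u => ?_
  obtain ⟨N, hN⟩ := hS u s
  have hN' : ∀ i, N + 1 ≤ i → ∀ t, S (s + 1 - i) t u = 0 := fun i hi t => by
    obtain ⟨j, rfl⟩ : ∃ j, i = j + 1 := ⟨i - 1, by omega⟩
    rw [show s + 1 - ((j + 1 : ℕ) : ℂ) = s - j by push_cast; ring, hN j (by omega)]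
  have h0 := (h (s + 1) t).apply_eq_sum_range (u := u) (N := N + 1) fun i hi => by
    rw [LinearMap.smul_apply, hN' i hi, smul_zero]
  have h1 := (hP s t).apply_eq_sum_range (u := u) (N := N + 1) fun i hi => by
    rw [LinearMap.smul_apply, AffineKZ.derivFst, LinearMap.smul_apply,
      show s - (i : ℂ) + 1 = s + 1 - i by ring, hN' i hi, smul_zero, smul_zero]
  have h2 := (h.derivSnd s t).apply_eq_sum_range (u := u) (N := N) fun i hi => by
    rw [LinearMap.smul_apply, AffineKZ.derivSnd, LinearMap.smul_apply, hN i hi, smul_zero,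
      smul_zero]
  rw [Pi.sub_apply, Pi.sub_apply, LinearMap.sub_apply, h1, h2, AffineKZ.derivFst,
    LinearMap.smul_apply, h0, Finset.sum_range_succ', Finset.sum_range_succ',
    add_sub_right_comm (Finset.sum (Finset.range N) _), ← Finset.sum_sub_distrib, smul_add,
    Finset.smul_sum]
  congr 1
  · refine Finset.sum_congr rfl fun i _ => ?_
    simp only [LinearMap.smul_apply, AffineKZ.derivFst, AffineKZ.derivSnd]
    rw [eq_of_args_eq (S := S) (show s - ((i + 1 : ℕ) : ℂ) + 1 = s - i by push_cast; ring)
        (show t + ((i + 1 : ℕ) : ℂ) = t + i + 1 by push_cast; ring),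
      eq_of_args_eq (S := S) (show s + 1 - ((i + 1 : ℕ) : ℂ) = s - i by push_cast; ring)
        (show t + ((i + 1 : ℕ) : ℂ) = t + i + 1 by push_cast; ring),
      show t + ((i + 1 : ℕ) : ℂ) = t + i + 1 by push_cast; ring, pow_succ]
    have := succ_mul_choose_succ (t + i) i
    simp only [smul_eq_mul]
    push_cast
    linear_combination -(-1) ^ i * S (s - i) (t + i + 1) u * this
  · simp [AffineKZ.derivFst]

/-- The two-variable system gives homogeneity and the ordinary differential equation. -/
theorem exists_isPowMulComp_of_system {S R : Series₂ E} (hS : TruncFst S) (hK : FinDegree S)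
    (hR : IsDivAdd (-1) S R) {κ : ℂ} (hκ : κ ≠ 0) {p q o : Module.End ℂ E}
    (h₁ : κ • derivFst S = op₂ p.dualMap (divFst S) - op₂ q.dualMap R)
    (h₂ : κ • derivSnd S = op₂ q.dualMap R + op₂ o.dualMap (divSnd S)) :
    ∃ F, IsPowMulComp (κ⁻¹ • (p.dualMap + q.dualMap + o.dualMap)) F S ∧
      ∃ Q, IsDivOneSub F Q ∧
        κ • deriv₁ F = op₁ p.dualMap (div₁ F) - op₁ q.dualMap Q := by
  -- The Euler equation: in `x` times the first equation plus `y` times the second, the terms with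
  -- `R` combine to `(y - x) R = S`.
  have heuler : ∀ s t, (p.dualMap + q.dualMap + o.dualMap) (S s t) = (κ * (s + t)) • S s t := by
    intro s t
    have e₁ := congrFun (congrFun h₁ (s - 1)) t
    have e₂ := congrFun (congrFun h₂ s) (t - 1)
    have e₃ := hR.mul_eq hS s t
    simp only [Pi.smul_apply, Pi.sub_apply, Pi.add_apply, derivFst, derivSnd, divFst, divSnd, op₂,
      sub_add_cancel] at e₁ e₂
    rw [mul_smul, add_smul, smul_add, e₁, e₂, LinearMap.add_apply, LinearMap.add_apply]
    rw [← e₃, map_add q.dualMap, map_smul q.dualMap]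
    module
  -- `F` is `S` at `y = 1`: the coefficient of `x^s` is summed over all total degrees `n`, finitely
  -- many on each vector.
  have hF : ∀ s, ∃ F, PointwiseSum (fun n => S s (n - s)) F := fun s =>
    PointwiseSum.exists_of_finite fun u => by
      obtain ⟨K, hK⟩ := hK u
      refine K.finite_toSet.subset fun n hn => ?_
      have := hK _ _ hn
      rwa [add_sub_cancel] at this
  choose F hF using hF
  have hFu : ∀ (u : E) (K : Finset ℂ), (∀ s t, S s t u ≠ 0 → s + t ∈ K) → ∀ s,
      F s u = ∑ n ∈ K, S s (n - s) u := fun u K hK s =>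
    (hF s).apply_eq_sum fun n hn => by
      by_contra h
      have := hK _ _ h
      rw [add_sub_cancel] at this
      exact hn this
  have hFt : ∀ u s, ∃ N : ℕ, ∀ i : ℕ, N ≤ i → F (s - i) u = 0 := fun u s => by
    obtain ⟨K, hK⟩ := hK u
    refine (hS u s).imp fun N hN i hi => ?_
    rw [hFu u K hK, Finset.sum_eq_zero fun n _ => hN i hi _]
  have hQ : ∀ s, ∃ Q, PointwiseSum (fun i : ℕ => F (s - i)) Q := fun s =>
    PointwiseSum.exists_of_bounded fun u => hFt u s
  choose Q hQ using hQ
  refine ⟨F, fun s => ⟨fun n => ?_, hF s⟩, Q, hQ, ?_⟩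
  · rw [LinearMap.smul_apply, heuler, smul_smul, add_sub_cancel, inv_mul_cancel_left₀ hκ]
  funext s
  refine LinearMap.ext fun u => ?_
  obtain ⟨K₁, hK₁⟩ := hK u
  obtain ⟨K₂, hK₂⟩ := hK (p u)
  obtain ⟨K₃, hK₃⟩ := hK (q u)
  -- The equation at `u` also evaluates the series at `p u` and `q u`, so one set of degrees has to
  -- serve all three vectors.
  set K := K₁ ∪ K₂ ∪ K₃ with hKdef
  have e₁ := hFu u K (fun s t h => by simp [hKdef, hK₁ s t h]) (s + 1)
  have e₂ := hFu (p u) K (fun s t h => by simp [hKdef, hK₂ s t h]) (s + 1)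
  have e₃ := hFu (q u) K (fun s t h => by simp [hKdef, hK₃ s t h])
  obtain ⟨N, hN⟩ := hS (q u) s
  -- Setting `y = 1` in `(y - x)⁻¹ S` gives `(1 - x)⁻¹ F`, by interchanging two finite sums.
  -- Division lowers the degree by one, so degree `n` of `S` matches the exponent `n - (s + 1)` of
  -- `y` in `R`.
  have e₄ : Q s (q u) = ∑ n ∈ K, R s (n - (s + 1)) (q u) := by
    have hr : ∀ n, R s (n - (s + 1)) (q u) = ∑ i ∈ Finset.range N, S (s - i) (n - (s - i)) (q u) :=
      fun n => by
        rw [(hR s (n - (s + 1))).apply_eq_sum_range (u := q u) (N := N)]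
        · refine Finset.sum_congr rfl fun i _ => ?_
          rw [neg_neg, one_pow, one_smul]
          congr 2
          ring
        · intro i hi
          rw [LinearMap.smul_apply, hN i hi, smul_zero]
    simp_rw [hr]
    rw [Finset.sum_comm, (hQ s).apply_eq_sum_range (u := q u) (N := N)]
    · exact Finset.sum_congr rfl fun i _ => e₃ _
    · intro i hi
      rw [e₃, Finset.sum_eq_zero fun n _ => hN i hi _]
  have e₅ : ∀ n, κ * ((s + 1) * S (s + 1) (n - (s + 1)) u) =
      S (s + 1) (n - (s + 1)) (p u) - R s (n - (s + 1)) (q u) := fun n =>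
    congrArg (fun d : Module.Dual ℂ E => d u) (congrFun (congrFun h₁ s) (n - (s + 1)))
  change κ * ((s + 1) * F (s + 1) u) = F (s + 1) (p u) - Q s (q u)
  rw [e₁, e₂, e₄, ← Finset.sum_sub_distrib, Finset.mul_sum, Finset.mul_sum]
  exact Finset.sum_congr rfl fun n _ => e₅ n

/-- The substitution `y ↦ y - x` transforms the system for iterates. -/
theorem IsShift.system {S T R : Series₂ E} (hS : TruncFst S) (hT : IsShift S T)
    (hR : IsDivAdd 1 S R) {κ : ℂ} {p q o : Module.End ℂ E}
    (h₁ : κ • AffineKZ.derivFst S =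
      AffineKZ.op₂ p.dualMap (AffineKZ.divFst S) + AffineKZ.op₂ o.dualMap R)
    (h₂ : κ • AffineKZ.derivSnd S =
      AffineKZ.op₂ q.dualMap (AffineKZ.divSnd S) + AffineKZ.op₂ o.dualMap R) :
    ∃ Q, IsDivAdd (-1) T Q ∧
      κ • AffineKZ.derivFst T =
        AffineKZ.op₂ p.dualMap (AffineKZ.divFst T) - AffineKZ.op₂ q.dualMap Q ∧
      κ • AffineKZ.derivSnd T =
        AffineKZ.op₂ q.dualMap Q + AffineKZ.op₂ o.dualMap (AffineKZ.divSnd T) := by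
  obtain ⟨Q, hQ⟩ := exists_isShift hS.divSnd
  obtain ⟨P, hP⟩ := exists_isShift hS.derivFst
  have hRt := hR.truncFst hS
  -- The factor `y + x` becomes `y`. If `V` is the substituted `R`, then `S = y R + x R` becomes `(y
  -- - x) V + x V = y V`, so `V = y⁻¹ T`.
  have hRT : IsShift R (AffineKZ.divSnd T) := by
    obtain ⟨V, hV⟩ := exists_isShift hRt
    have hY : TruncFst fun s t => R s (t - 1) := fun u s =>
      (hRt u s).imp fun _ hN i hi t => hN i hi (t - 1)
    obtain ⟨U, hU⟩ := exists_isShift hY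
    have hV' : IsShift (AffineKZ.divSnd fun s t => R s (t - 1)) V := by
      convert hV using 1
      funext s t
      rw [AffineKZ.divSnd, add_sub_cancel_right]
    have hX : IsShift (fun s t => R (s - 1) t) fun s t => V (s - 1) t := fun s t => by
      convert hV (s - 1) t using 2 with i
      change _ • R (s - i - 1) _ = _
      rw [show s - (i : ℂ) - 1 = s - 1 - i by ring]
    have hYX : (fun s t => R s (t - 1)) + (fun s t => R (s - 1) t) = S := by
      funext s t
      have := hR.mul_eq hS s t
      rwa [one_smul] at this
    have hTU : T = U + fun s t => V (s - 1) t := hT.unique (hYX ▸ hU.add hX)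
    convert hV using 1
    funext s t
    have := IsShift.mul_snd hY hU hV' s (t + 1)
    rw [add_sub_cancel_right] at this
    rw [AffineKZ.divSnd, hTU, Pi.add_apply, Pi.add_apply, ← this, sub_add_cancel]
  have e₁ : κ • P = AffineKZ.op₂ p.dualMap (AffineKZ.divFst T) +
      AffineKZ.op₂ o.dualMap (AffineKZ.divSnd T) := by
    refine (hP.smul κ).unique ?_
    rw [h₁]
    exact (hT.divFst.op₂ p).add (hRT.op₂ o)
  have e₂ : κ • AffineKZ.derivSnd T = AffineKZ.op₂ q.dualMap Q +
      AffineKZ.op₂ o.dualMap (AffineKZ.divSnd T) := by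
    refine (hT.derivSnd.smul κ).unique ?_
    rw [h₂]
    exact (hQ.op₂ q).add (hRT.op₂ o)
  -- `Q` is the substituted `y⁻¹ S`; it is the expansion of `(y - x)⁻¹ T` because it is truncated
  -- and `(y - x) Q = T`.
  refine ⟨Q, isDivAdd_of_mul_eq (hQ.truncFst hS.divSnd) fun s t => ?_, ?_, e₂⟩
  · rw [neg_one_smul, ← sub_eq_add_neg]
    exact IsShift.mul_snd hS hT hQ s t
  -- By the chain rule the two equations are subtracted, and the terms `o (y⁻¹ T)` cancel.
  · rw [IsShift.derivFst hS hT hP, smul_sub, e₁, e₂]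
    abel

end Series

theorem finite_support_of_bounded {M : Type*} [Zero M] {f : ℕ → M} {N : ℕ}
    (h : ∀ i, N ≤ i → f i = 0) : (Function.support f).Finite :=
  (Set.finite_Iio N).subset fun i hi => by
    by_contra h'
    exact hi (h i (not_lt.mp h'))

/-! ### Current modes on modules and their exchange with intertwining operators -/

section Modules

variable {g : Type*} [LieRing g] [LieAlgebra ℂ g] [FiniteDimensional ℂ g]
  [LieAlgebra.IsSimple ℂ g] {H : LieSubalgebra ℂ g} [H.IsCartanSubalgebra]
  {ι : Type*} [Fintype ι] [DecidableEq ι] {ℓ : ℕ} {γ : OrthoBasis H ι}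

namespace LModule

variable {W : Type*} [AddCommGroup W] [Module ℂ W] (A : LModule ℓ γ W)

/-- The operator `x(n)` on a module. -/
def mode (x : g) (n : ℤ) : Module.End ℂ W := A.Y (cur H ℓ x) n

theorem coe_topAct (x : g) (u : A.top) : (A.topAct x u : W) = A.mode x 0 u := rfl

theorem mode_top (x : g) {n : ℤ} (hn : 0 < n) {w : W} (hw : w ∈ A.top) : A.mode x n w = 0 :=
  hw 1 (cur H ℓ x) n (by rw [virV_zero_cur, Int.cast_one, one_smul]) (by omega)

theorem exists_mode_eq_zero (x : g) (w : W) : ∃ N : ℕ, ∀ i : ℕ, N ≤ i → A.mode x i w = 0 := by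
  obtain ⟨N, hN⟩ := A.truncated (cur H ℓ x) w
  exact ⟨N.toNat, fun i hi => hN i (by omega)⟩

/-- On the contragredient module the mode `-n` of a weight-one vector killed by `L(1)` is minus the
transpose of the mode `n`. Thus annihilation by positive modes on `W'` becomes vanishing after
negative modes on `W`. -/
theorem topDual_mode {f : Module.Dual ℂ W} (hf : A.IsTopDual f) (x : g) {n : ℤ} (hn : n < 0)
    (w : W) : f (A.mode x n w) = 0 := by
  have h := hf.annihilated 1 (cur H ℓ x) (-n) (by rw [virV_zero_cur, Int.cast_one, one_smul])
    (by omega) w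
  rw [contraMode, finsum_eq_single _ 0] at h
  · simpa [mode] using h
  · intro j hj
    obtain ⟨k, rfl⟩ := Nat.exists_eq_succ_of_ne_zero hj
    rw [pow_succ, Module.End.mul_apply, virV_one_cur]
    simp

/-- The Sugawara formula, from the Jacobi identity with `p = -1` and `q = r = 0`. Its two halves
coincide as both vectors are the same current, and the resulting `2` cancels the `1/2` in `ω`. -/
theorem L_neg_one (w : W) : ((ℓ : ℂ) + dualCoxeter γ) • A.L (-1) w =
    ∑ i, ∑ᶠ j : ℕ, A.mode (γ.toBasis i) (-1 - j) (A.mode (γ.toBasis i) j w) := by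
  have h : ∀ i, A.Y (act H ℓ (-1) (γ.toBasis i) (act H ℓ (-1) (γ.toBasis i) (vac H ℓ))) 0 w =
      (2 : ℂ) • ∑ᶠ j : ℕ, A.mode (γ.toBasis i) (-1 - j) (A.mode (γ.toBasis i) j w) := fun i => by
    have h := A.jacobi _ (cur H ℓ (γ.toBasis i)) _ (isVertexOperator_current ℓ (γ.toBasis i)) w
      (-1) 0 0
    rw [finsum_eq_single (fun i_1 : ℕ => Ring.choose ((0 : ℤ) : ℂ) i_1 • _) 0
      (fun i hi => by simp [Ring.choose_zero_ite, hi])] at h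
    rw [Int.cast_zero, Ring.choose_zero_right, one_smul] at h
    refine Eq.trans h.symm ?_
    obtain ⟨N, hN⟩ := A.exists_mode_eq_zero (γ.toBasis i) w
    rw [smul_finsum' _ (finite_support_of_bounded (N := N) fun j hj => by rw [hN j hj, map_zero])]
    refine finsum_congr fun j => ?_
    rw [neg_one_pow_mul_choose_neg_one, one_smul, zpow_neg_one, add_zero, zero_add, inv_neg,
      inv_one, neg_one_smul, sub_neg_eq_add]
    exact (two_smul ℂ _).symm
  rw [L, omega, map_smul, map_sum, Pi.smul_apply, Finset.sum_apply, LinearMap.smul_apply,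
    LinearMap.sum_apply]
  simp only [neg_add_cancel, h]
  rw [← Finset.smul_sum, smul_smul, smul_smul, mul_inv]
  have := level_add_dualCoxeter_ne_zero γ ℓ
  rw [show ((ℓ : ℂ) + dualCoxeter γ) * (2⁻¹ * ((ℓ : ℂ) + dualCoxeter γ)⁻¹) * 2 =
    ((ℓ : ℂ) + dualCoxeter γ) * ((ℓ : ℂ) + dualCoxeter γ)⁻¹ by ring, mul_inv_cancel₀ this, one_smul]

theorem L_neg_one_top {w : W} (hw : w ∈ A.top) : ((ℓ : ℂ) + dualCoxeter γ) • A.L (-1) w =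
    ∑ i, A.mode (γ.toBasis i) (-1) (A.mode (γ.toBasis i) 0 w) := by
  rw [A.L_neg_one]
  refine Finset.sum_congr rfl fun i _ => ?_
  rw [finsum_eq_single _ 0 fun j hj => by rw [A.mode_top _ (by omega) hw, map_zero]]
  simp

end LModule

namespace Intertwiner

variable {W₁ W₂ W₃ : Type*} [AddCommGroup W₁] [Module ℂ W₁] [AddCommGroup W₂] [Module ℂ W₂]
  [AddCommGroup W₃] [Module ℂ W₃]
  {A₁ : LModule ℓ γ W₁} {A₂ : LModule ℓ γ W₂} {A₃ : LModule ℓ γ W₃} (I : Intertwiner A₁ A₂ A₃)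

theorem commutator (v : LVac H ℓ) (w₁ : W₁) (w₂ : W₂) (q : ℤ) (r : ℂ) :
    A₃.Y v q (I.mode r w₁ w₂) = I.mode r w₁ (A₂.Y v q w₂) +
      ∑ᶠ i : ℕ, (Ring.choose q i : ℂ) • I.mode (q + r - i) (A₁.Y v i w₁) w₂ := by
  have h := I.jacobi v w₁ w₂ 0 q r
  rw [finsum_eq_single _ 0 (fun i hi => by simp [Ring.choose_zero_ite, hi])] at h
  simp only [Ring.choose_zero_right, pow_zero, mul_one, one_smul, Nat.cast_zero, Int.cast_zero,
    add_zero, sub_zero, zero_add, zpow_zero] at h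
  rw [← h, add_sub_cancel]

theorem commutator_top (x : g) {w₁ : W₁} (hw₁ : w₁ ∈ A₁.top) (w₂ : W₂) (q : ℤ) (r : ℂ) :
    A₃.mode x q (I.mode r w₁ w₂) = I.mode r w₁ (A₂.mode x q w₂) +
      I.mode (q + r) (A₁.mode x 0 w₁) w₂ := by
  rw [LModule.mode, I.commutator, finsum_eq_single _ 0]
  · simp [LModule.mode]
  · intro i hi
    have := A₁.mode_top x (n := i) (by omega) hw₁
    rw [LModule.mode] at this
    rw [this, map_zero, LinearMap.zero_apply, smul_zero]

theorem iterate (x : g) (w₁ : W₁) (w₂ : W₂) (p : ℤ) (r : ℂ) :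
    I.mode r (A₁.mode x p w₁) w₂ = ∑ᶠ i : ℕ, ((-1 : ℂ) ^ i * (Ring.choose p i : ℂ)) •
        (A₃.mode x (p - i) (I.mode (r + i) w₁ w₂) -
          (-1 : ℂ) ^ p • I.mode (p + r - i) w₁ (A₂.mode x i w₂)) := by
  have h := I.jacobi (cur H ℓ x) w₁ w₂ p 0 r
  rw [finsum_eq_single (fun i : ℕ => Ring.choose ((0 : ℤ) : ℂ) i • _) 0
    (fun i hi => by simp [Ring.choose_zero_ite, hi])] at h
  simp only [Ring.choose_zero_right, one_smul, Nat.cast_zero, Int.cast_zero,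
    add_zero, sub_zero, zero_add] at h
  exact h.symm

theorem exists_bound_iterate (x : g) (w₁ : W₁) (w₂ : W₂) (r : ℂ) :
    ∃ N : ℕ, ∀ i : ℕ, N ≤ i → I.mode (r + i) w₁ w₂ = 0 ∧ A₂.mode x i w₂ = 0 := by
  obtain ⟨N, hN⟩ := I.truncated w₁ w₂ r
  obtain ⟨M, hM⟩ := A₂.exists_mode_eq_zero x w₂
  exact ⟨max N M, fun i hi => ⟨hN i (by omega), hM i (by omega)⟩⟩

theorem apply_iterate (h : Module.Dual ℂ W₃) (x : g) (w₁ : W₁) (w₂ : W₂) (p : ℤ) (r : ℂ) :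
    h (I.mode r (A₁.mode x p w₁) w₂) = ∑ᶠ i : ℕ, ((-1 : ℂ) ^ i * (Ring.choose p i : ℂ)) *
        (h (A₃.mode x (p - i) (I.mode (r + i) w₁ w₂)) -
          (-1 : ℂ) ^ p * h (I.mode (p + r - i) w₁ (A₂.mode x i w₂))) := by
  obtain ⟨N, hN⟩ := I.exists_bound_iterate x w₁ w₂ r
  rw [I.iterate, map_finsum h]
  · refine finsum_congr fun i => ?_
    rw [map_smul, map_sub, map_smul, smul_eq_mul, smul_eq_mul]
  · refine finite_support_of_bounded (N := N) fun i hi => ?_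
    rw [(hN i hi).1, (hN i hi).2]
    simp

/-- The Jacobi identity with `p = -1`, `q = 0`: modes either leave to the left as `x(-1 - i)` or act
on `w₂` as `x(i)`, where only `i = 0` survives. The functional is arbitrary so that it may contain a
further intertwining operator. -/
theorem apply_neg_one (h : Module.Dual ℂ W₃) (x : g) (w₁ : W₁) {w₂ : W₂} (hw₂ : w₂ ∈ A₂.top)
    (r : ℂ) : h (I.mode r (A₁.mode x (-1) w₁) w₂) =
      ∑ᶠ i : ℕ, h (A₃.mode x (-1 - i) (I.mode (r + i) w₁ w₂)) +
        h (I.mode (r - 1) w₁ (A₂.mode x 0 w₂)) := by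
  obtain ⟨N, hN⟩ := I.exists_bound_iterate x w₁ w₂ r
  have e : h (I.mode (r - 1) w₁ (A₂.mode x 0 w₂)) =
      ∑ᶠ i : ℕ, h (I.mode (r - 1 - i) w₁ (A₂.mode x i w₂)) := by
    rw [finsum_eq_single _ 0 fun i hi => by
      rw [A₂.mode_top x (by omega) hw₂, map_zero, map_zero]]
    simp
  rw [e, I.apply_iterate, ← finsum_add_distrib
    (finite_support_of_bounded (N := N) fun i hi => by rw [(hN i hi).1, map_zero, map_zero])
    (finite_support_of_bounded (N := N) fun i hi => by rw [(hN i hi).2, map_zero, map_zero])]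
  refine finsum_congr fun i => ?_
  rw [neg_one_pow_mul_choose_neg_one, one_mul, zpow_neg_one, inv_neg, inv_one, neg_one_mul,
    sub_neg_eq_add, show ((-1 : ℤ) : ℂ) + r - i = r - 1 - i by push_cast; ring]

/-- The action of modes of negative degree inside a functional annihilated by them on the left. -/
theorem topDual_apply_neg_one {f : Module.Dual ℂ W₃} (hf : A₃.IsTopDual f) (x : g) (w₁ : W₁)
    (w₂ : W₂) (r : ℂ) : f (I.mode r (A₁.mode x (-1) w₁) w₂) =
      ∑ᶠ i : ℕ, f (I.mode (r - 1 - i) w₁ (A₂.mode x i w₂)) := by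
  rw [I.apply_iterate]
  refine finsum_congr fun i => ?_
  rw [neg_one_pow_mul_choose_neg_one, one_mul, A₃.topDual_mode hf x (by omega), zpow_neg_one,
    zero_sub, inv_neg, inv_one, neg_one_mul, neg_neg, show ((-1 : ℤ) : ℂ) + r - i = r - 1 - i by
      push_cast; ring]

/-- With a lowest-weight vector on the right and a functional in `T(W₃')` on the left, the iterate
formula collapses to one term. The signs `(-1)^i`, for varying `i`, make up the expansion of `(x₂ +
x₀)⁻¹`. -/
theorem topDual_apply_neg {f : Module.Dual ℂ W₃} (hf : A₃.IsTopDual f) (x : g) (w₁ : W₁)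
    {w₂ : W₂} (hw₂ : w₂ ∈ A₂.top) (r : ℂ) (i : ℕ) :
    f (I.mode r (A₁.mode x (-1 - i) w₁) w₂) =
      (-1) ^ i * f (I.mode (r - 1 - i) w₁ (A₂.mode x 0 w₂)) := by
  rw [I.apply_iterate, finsum_eq_single _ 0]
  · rw [A₃.topDual_mode hf x (by omega)]
    have : (-1 : ℂ) ^ (-1 - (i : ℤ)) = -(-1) ^ i := by
      rw [zpow_sub₀ (by norm_num), zpow_neg_one, zpow_natCast, inv_neg, inv_one, neg_div, one_div,
        ← inv_pow, inv_neg, inv_one]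
    rw [this, show ((-1 - (i : ℤ) : ℤ) : ℂ) + r - (0 : ℕ) = r - 1 - i by push_cast; ring]
    simp
  · intro j hj
    rw [A₃.topDual_mode hf x (by omega), A₂.mode_top x (by omega) hw₂]
    simp

/-- The commutator formula for `ω` at mode `1` has just two terms, with `L(-1)` and `L(0)` acting on
`w₁`; the derivative axiom evaluates the first. -/
theorem L_zero_mode (w₁ : W₁) (w₂ : W₂) (r : ℂ) :
    A₃.L 0 (I.mode r w₁ w₂) = I.mode r w₁ (A₂.L 0 w₂) + I.mode r (A₁.L 0 w₁) w₂ -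
      (r + 1) • I.mode r w₁ w₂ := by
  have h := I.commutator (omega ℓ γ) w₁ w₂ 1 r
  rw [finsum_eq_sum_of_support_subset (s := Finset.range 2)] at h
  · have e := I.derivative w₁ (r + 1)
    rw [LModule.L, neg_add_cancel, add_sub_cancel_right] at e
    simp only [Finset.sum_range_succ, Finset.sum_range_zero, Ring.choose_zero_right,
      Ring.choose_one_right, Int.cast_one, Nat.cast_zero, Nat.cast_one, one_smul, zero_add,
      sub_zero, add_comm (1 : ℂ) r, add_sub_cancel_right, e] at h
    simp only [LModule.L, zero_add, h, LinearMap.smul_apply]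
    module
  · intro i hi
    by_contra h'
    have : 2 ≤ i := not_lt.mp fun h => h' (Finset.mem_coe.mpr (Finset.mem_range.mpr h))
    refine hi ?_
    have hc : Ring.choose ((1 : ℤ) : ℂ) i = 0 := by
      have := Ring.choose_natCast (R := ℂ) 1 i
      rw [Nat.choose_eq_zero_of_lt (by omega)] at this
      simpa using this
    simp only [hc, zero_smul]

theorem mode_mem_weightSpace {w₁ : W₁} {w₂ : W₂} {h₁ h₂ : ℂ} (hw₁ : w₁ ∈ A₁.weightSpace h₁)
    (hw₂ : w₂ ∈ A₂.weightSpace h₂) (r : ℂ) :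
    I.mode r w₁ w₂ ∈ A₃.weightSpace (h₁ + h₂ - r - 1) := by
  rw [LModule.weightSpace, Module.End.mem_eigenspace_iff] at *
  rw [L_zero_mode, hw₁, hw₂]
  simp only [map_smul, LinearMap.smul_apply]
  module

end Intertwiner

end Modules

/-! ### The operators `Ω` as transposes, and reduction to pure tensors and homogeneous vectors -/

section Casimir

variable {g : Type*} [LieRing g] [LieAlgebra ℂ g] [FiniteDimensional ℂ g]
  [LieAlgebra.IsSimple ℂ g] {H : LieSubalgebra ℂ g} [H.IsCartanSubalgebra]
  {ι : Type*} [Fintype ι] [DecidableEq ι] {ℓ : ℕ} {γ : OrthoBasis H ι}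
  {W₁ W₂ W₃ : Type*} [AddCommGroup W₁] [Module ℂ W₁]
  [AddCommGroup W₂] [Module ℂ W₂] [AddCommGroup W₃] [Module ℂ W₃]
  (A₁ : LModule ℓ γ W₁) (A₂ : LModule ℓ γ W₂) (A₃ : LModule ℓ γ W₃)

/-- The operator `∑ γᵢ ⊗ γᵢ ⊗ 1`. -/
def casimir12 : Module.End ℂ (TopTensor A₁ A₂ A₃) :=
  ∑ i, TensorProduct.map (TensorProduct.map (A₁.topAct (γ.toBasis i)) (A₂.topAct (γ.toBasis i)))
    LinearMap.id

/-- The operator `∑ γᵢ ⊗ 1 ⊗ γᵢ`. -/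
def casimir13 : Module.End ℂ (TopTensor A₁ A₂ A₃) :=
  ∑ i, TensorProduct.map (TensorProduct.map (A₁.topAct (γ.toBasis i)) LinearMap.id)
    (A₃.topAct (γ.toBasis i))

/-- The operator `∑ 1 ⊗ γᵢ ⊗ γᵢ`. -/
def casimir23 : Module.End ℂ (TopTensor A₁ A₂ A₃) :=
  ∑ i, TensorProduct.map (TensorProduct.map LinearMap.id (A₂.topAct (γ.toBasis i)))
    (A₃.topAct (γ.toBasis i))

/-- Transposes respect pointwise sums of functionals, which an arbitrary endomorphism of an
infinite-dimensional dual need not do; the formal calculus is therefore stated for operators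
`a.dualMap`. -/
theorem Omega12_eq_dualMap : Omega12 A₁ A₂ A₃ = (casimir12 A₁ A₂ A₃).dualMap := by
  refine LinearMap.ext fun d => LinearMap.ext fun u => ?_
  simp [Omega12, casimir12, LinearMap.sum_apply, LinearMap.dualMap_apply]

theorem Omega13_eq_dualMap : Omega13 A₁ A₂ A₃ = (casimir13 A₁ A₂ A₃).dualMap := by
  refine LinearMap.ext fun d => LinearMap.ext fun u => ?_
  simp [Omega13, casimir13, LinearMap.sum_apply, LinearMap.dualMap_apply]

theorem Omega23_eq_dualMap : Omega23 A₁ A₂ A₃ = (casimir23 A₁ A₂ A₃).dualMap := by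
  refine LinearMap.ext fun d => LinearMap.ext fun u => ?_
  simp [Omega23, casimir23, LinearMap.sum_apply, LinearMap.dualMap_apply]

variable {A₁ A₂ A₃}

theorem Omega12_apply (d : Module.Dual ℂ (TopTensor A₁ A₂ A₃)) (u₁ : A₁.top) (u₂ : A₂.top)
    (u₃ : A₃.top) : Omega12 A₁ A₂ A₃ d ((u₁ ⊗ₜ u₂) ⊗ₜ u₃) =
      ∑ i, d ((A₁.topAct (γ.toBasis i) u₁ ⊗ₜ A₂.topAct (γ.toBasis i) u₂) ⊗ₜ u₃) := by
  simp [Omega12, LinearMap.sum_apply]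

theorem Omega13_apply (d : Module.Dual ℂ (TopTensor A₁ A₂ A₃)) (u₁ : A₁.top) (u₂ : A₂.top)
    (u₃ : A₃.top) : Omega13 A₁ A₂ A₃ d ((u₁ ⊗ₜ u₂) ⊗ₜ u₃) =
      ∑ i, d ((A₁.topAct (γ.toBasis i) u₁ ⊗ₜ u₂) ⊗ₜ A₃.topAct (γ.toBasis i) u₃) := by
  simp [Omega13, LinearMap.sum_apply]

theorem Omega23_apply (d : Module.Dual ℂ (TopTensor A₁ A₂ A₃)) (u₁ : A₁.top) (u₂ : A₂.top)
    (u₃ : A₃.top) : Omega23 A₁ A₂ A₃ d ((u₁ ⊗ₜ u₂) ⊗ₜ u₃) =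
      ∑ i, d ((u₁ ⊗ₜ A₂.topAct (γ.toBasis i) u₂) ⊗ₜ A₃.topAct (γ.toBasis i) u₃) := by
  simp [Omega23, LinearMap.sum_apply]

theorem topTensor_induction {P : TopTensor A₁ A₂ A₃ → Prop} (h0 : P 0)
    (hadd : ∀ u v, P u → P v → P (u + v))
    (ht : ∀ u₁ u₂ u₃, P ((u₁ ⊗ₜ u₂) ⊗ₜ u₃)) (u : TopTensor A₁ A₂ A₃) : P u := by
  induction u using TensorProduct.induction_on with
  | zero => exact h0
  | add u v hu hv => exact hadd u v hu hv
  | tmul x u₃ =>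
    induction x using TensorProduct.induction_on with
    | zero => rw [TensorProduct.zero_tmul]; exact h0
    | add u v hu hv => rw [TensorProduct.add_tmul]; exact hadd _ _ hu hv
    | tmul u₁ u₂ => exact ht u₁ u₂ u₃

theorem truncFst_of_tmul {S : Series₂ (TopTensor A₁ A₂ A₃)}
    (h : ∀ u₁ u₂ u₃ s, ∃ N : ℕ, ∀ i : ℕ, N ≤ i → ∀ t, S (s - i) t ((u₁ ⊗ₜ u₂) ⊗ₜ u₃) = 0) :
    TruncFst S := fun u s => by
  induction u using topTensor_induction with
  | h0 => exact ⟨0, fun i _ t => map_zero _⟩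
  | hadd u v hu hv =>
    obtain ⟨N, hN⟩ := hu
    obtain ⟨M, hM⟩ := hv
    refine ⟨max N M, fun i hi t => ?_⟩
    rw [map_add, hN i (by omega), hM i (by omega), add_zero]
  | ht u₁ u₂ u₃ => exact h u₁ u₂ u₃ s

theorem finDegree_of_tmul {S : Series₂ (TopTensor A₁ A₂ A₃)}
    (h : ∀ u₁ u₂ u₃, ∃ K : Finset ℂ, ∀ s t, S s t ((u₁ ⊗ₜ u₂) ⊗ₜ u₃) ≠ 0 → s + t ∈ K) :
    FinDegree S := fun u => by
  classical
  induction u using topTensor_induction with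
  | h0 => exact ⟨∅, fun s t h => absurd (map_zero _) h⟩
  | hadd u v hu hv =>
    obtain ⟨K, hK⟩ := hu
    obtain ⟨M, hM⟩ := hv
    refine ⟨K ∪ M, fun s t hst => ?_⟩
    rw [Finset.mem_union]
    by_contra! h'
    refine hst ?_
    rw [map_add, not_not.mp fun h => h'.1 (hK s t h), not_not.mp fun h => h'.2 (hM s t h),
      add_zero]
  | ht u₁ u₂ u₃ => exact h u₁ u₂ u₃

theorem LModule.weight_induction {W : Type*} [AddCommGroup W] [Module ℂ W] (A : LModule ℓ γ W)
    {P : W → Prop} (h0 : P 0) (hadd : ∀ u v, P u → P v → P (u + v))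
    (hw : ∀ h, ∀ w ∈ A.weightSpace h, P w) (w : W) : P w := by
  have hmem : w ∈ ⨆ h : ℂ, A.weightSpace h := by
    have := A.grading
    rw [← zero_add (1 : ℤ)] at this
    change ⨆ h : ℂ, A.weightSpace h = ⊤ at this
    rw [this]
    trivial
  exact Submodule.iSup_induction _ (motive := P) hmem hw h0 hadd

theorem exists_finset_add {M : Type*} [AddCommGroup M] {c : ℂ → ℂ → M → ℂ}
    (hc : ∀ s t u v, c s t (u + v) = c s t u + c s t v) {u v : M}
    (hu : ∃ K : Finset ℂ, ∀ s t, c s t u ≠ 0 → s + t ∈ K)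
    (hv : ∃ K : Finset ℂ, ∀ s t, c s t v ≠ 0 → s + t ∈ K) :
    ∃ K : Finset ℂ, ∀ s t, c s t (u + v) ≠ 0 → s + t ∈ K := by
  classical
  obtain ⟨K, hK⟩ := hu
  obtain ⟨M, hM⟩ := hv
  refine ⟨K ∪ M, fun s t hst => ?_⟩
  rw [Finset.mem_union]
  by_contra! h'
  refine hst ?_
  rw [hc, not_not.mp fun h => h'.1 (hK s t h), not_not.mp fun h => h'.2 (hM s t h), add_zero]

theorem exists_finset_zero {M : Type*} [AddCommGroup M] {c : ℂ → ℂ → M → ℂ}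
    (hc : ∀ s t u v, c s t (u + v) = c s t u + c s t v) :
    ∃ K : Finset ℂ, ∀ s t, c s t 0 ≠ 0 → s + t ∈ K :=
  ⟨∅, fun s t h => absurd (by simpa using hc s t 0 0) h⟩

/-- By trilinearity it suffices to treat homogeneous vectors, where the total degree is a weight in
`S` minus the sum of the three given weights. -/
theorem exists_degree_bound (c : ℂ → ℂ → W₁ → W₂ → W₃ → ℂ)
    (h₁ : ∀ s t u v w₂ w₃, c s t (u + v) w₂ w₃ = c s t u w₂ w₃ + c s t v w₂ w₃)
    (h₂ : ∀ s t w₁ u v w₃, c s t w₁ (u + v) w₃ = c s t w₁ u w₃ + c s t w₁ v w₃)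
    (h₃ : ∀ s t w₁ w₂ u v, c s t w₁ w₂ (u + v) = c s t w₁ w₂ u + c s t w₁ w₂ v) {S : Finset ℂ}
    (hc : ∀ k₁ k₂ k₃, ∀ w₁ ∈ A₁.weightSpace k₁, ∀ w₂ ∈ A₂.weightSpace k₂,
      ∀ w₃ ∈ A₃.weightSpace k₃, ∀ s t, c s t w₁ w₂ w₃ ≠ 0 → k₁ + k₂ + k₃ + (s + t) ∈ S)
    (w₁ : W₁) (w₂ : W₂) (w₃ : W₃) : ∃ K : Finset ℂ, ∀ s t, c s t w₁ w₂ w₃ ≠ 0 → s + t ∈ K := by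
  induction w₁ using A₁.weight_induction with
  | h0 => exact exists_finset_zero (c := fun s t w => c s t w w₂ w₃) fun s t u v => h₁ s t u v _ _
  | hadd u v hu hv =>
    exact exists_finset_add (c := fun s t w => c s t w w₂ w₃) (fun s t u v => h₁ s t u v _ _) hu hv
  | hw k₁ w₁ hw₁ =>
    induction w₂ using A₂.weight_induction with
    | h0 => exact exists_finset_zero (c := fun s t w => c s t w₁ w w₃) fun s t u v => h₂ s t _ u v _
    | hadd u v hu hv =>
      exact exists_finset_add (c := fun s t w => c s t w₁ w w₃) (fun s t u v => h₂ s t _ u v _) hu hv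
    | hw k₂ w₂ hw₂ =>
      induction w₃ using A₃.weight_induction with
      | h0 => exact exists_finset_zero (c := fun s t w => c s t w₁ w₂ w) fun s t u v => h₃ s t _ _ u v
      | hadd u v hu hv =>
        exact exists_finset_add (c := fun s t w => c s t w₁ w₂ w) (fun s t u v => h₃ s t _ _ u v)
          hu hv
      | hw k₃ w₃ hw₃ =>
        classical
        refine ⟨S.image fun k => k - (k₁ + k₂ + k₃), fun s t hst => Finset.mem_image.mpr
          ⟨_, hc k₁ k₂ k₃ w₁ hw₁ w₂ hw₂ w₃ hw₃ s t hst, ?_⟩⟩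
        ring

end Casimir

/-! ### The Knizhnik–Zamolodchikov systems for iterates and products -/

section Correlators

variable {g : Type*} [LieRing g] [LieAlgebra ℂ g] [FiniteDimensional ℂ g]
  [LieAlgebra.IsSimple ℂ g] {H : LieSubalgebra ℂ g} [H.IsCartanSubalgebra]
  {ι : Type*} [Fintype ι] [DecidableEq ι] {ℓ : ℕ} {γ : OrthoBasis H ι}
  {W₁ W₂ W₃ W₄ N : Type*} [AddCommGroup W₁] [Module ℂ W₁]
  [AddCommGroup W₂] [Module ℂ W₂] [AddCommGroup W₃] [Module ℂ W₃]
  [AddCommGroup W₄] [Module ℂ W₄] [AddCommGroup N] [Module ℂ N]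
  {A₁ : LModule ℓ γ W₁} {A₂ : LModule ℓ γ W₂} {A₃ : LModule ℓ γ W₃} {A₄ : LModule ℓ γ W₄}
  {B : LModule ℓ γ N} {f : Module.Dual ℂ W₄}

section Iterate

variable (I : Intertwiner B A₃ A₄) (J : Intertwiner A₁ A₂ B)

theorem truncFst_iterateSeries (f : Module.Dual ℂ W₄) : TruncFst (iterateSeries f I J) :=
  truncFst_of_tmul fun u₁ u₂ u₃ s => by
    obtain ⟨N, hN⟩ := J.truncated (u₁ : W₁) (u₂ : W₂) (-s - 1)
    refine ⟨N, fun i hi t => ?_⟩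
    rw [iterateSeries_apply, show -(s - (i : ℂ)) - 1 = -s - 1 + i by ring, hN i hi]
    simp

theorem finDegree_iterateSeries (hf : A₄.IsTopDual f) : FinDegree (iterateSeries f I J) :=
  finDegree_of_tmul fun u₁ u₂ u₃ => by
    obtain ⟨S, hS⟩ := hf.graded
    refine exists_degree_bound (A₁ := A₁) (A₂ := A₂) (A₃ := A₃)
      (fun s t w₁ w₂ w₃ => f (I.mode (-t - 1) (J.mode (-s - 1) w₁ w₂) w₃))
      (fun _ _ _ _ _ _ => by simp) (fun _ _ _ _ _ _ => by simp) (fun _ _ _ _ _ _ => by simp)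
      (S := S) (fun k₁ k₂ k₃ w₁ hw₁ w₂ hw₂ w₃ hw₃ s t hst => ?_) u₁ u₂ u₃
    by_contra h
    have := I.mode_mem_weightSpace (J.mode_mem_weightSpace hw₁ hw₂ (-s - 1)) hw₃ (-t - 1)
    rw [show k₁ + k₂ - (-s - 1) - 1 + k₃ - (-t - 1) - 1 = k₁ + k₂ + k₃ + (s + t) by ring] at this
    exact hst (hS _ h _ this)

/-- `x(-1)` leaves the inner operator as the modes `x(-1 - i)` on the intermediate module, each of
which the outer operator passes to `u₃` as `x(0)`; the rest is `x(0)` on `u₂`. The former yields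
`Ω₁₃ / (x₂ + x₀)`, the latter `Ω₁₂ / x₀`. -/
theorem iterate_apply_neg_one (hf : A₄.IsTopDual f) (x : g) (w₁ : W₁) {u₂ : W₂} {u₃ : W₃}
    (hu₂ : u₂ ∈ A₂.top) (hu₃ : u₃ ∈ A₃.top) (a b : ℂ) :
    f (I.mode a (J.mode b (A₁.mode x (-1) w₁) u₂) u₃) =
      ∑ᶠ i : ℕ, (-1) ^ i * f (I.mode (a - 1 - i) (J.mode (b + i) w₁ u₂) (A₃.mode x 0 u₃)) +
        f (I.mode a (J.mode (b - 1) w₁ (A₂.mode x 0 u₂)) u₃) := by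
  have h := J.apply_neg_one (f ∘ₗ (I.mode a).flip u₃) x w₁ hu₂ b
  simp only [LinearMap.comp_apply, LinearMap.flip_apply] at h
  rw [h]
  congr 1
  exact finsum_congr fun i => I.topDual_apply_neg hf x _ hu₃ a i

/-- The vector under `L(-1)` need not be of lowest weight, so the whole Sugawara sum is needed. Its
outer modes pass to `u₃` as zero modes. Its inner modes `x(j)` cross the inner operator, acting as
`x(0)` on `u₁` for every `j` but on `u₂` only for `j = 0`. This asymmetry produces `Ω₁₃ / (x₂ + x₀)`
next to `Ω₂₃ / x₂`. -/
theorem iterate_apply_L_neg_one (hf : A₄.IsTopDual f) {u₁ : W₁} {u₂ : W₂} {u₃ : W₃}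
    (hu₁ : u₁ ∈ A₁.top) (hu₂ : u₂ ∈ A₂.top) (hu₃ : u₃ ∈ A₃.top) (a b : ℂ) :
    ((ℓ : ℂ) + dualCoxeter γ) * f (I.mode a (B.L (-1) (J.mode b u₁ u₂)) u₃) =
      ∑ k, (f (I.mode (a - 1) (J.mode b u₁ (A₂.mode (γ.toBasis k) 0 u₂))
          (A₃.mode (γ.toBasis k) 0 u₃)) +
        ∑ᶠ i : ℕ, (-1) ^ i * f (I.mode (a - 1 - i)
          (J.mode (b + i) (A₁.mode (γ.toBasis k) 0 u₁) u₂) (A₃.mode (γ.toBasis k) 0 u₃))) := by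
  rw [← smul_eq_mul, ← map_smul, ← LinearMap.smul_apply, ← map_smul, B.L_neg_one, map_sum,
    LinearMap.sum_apply, map_sum]
  refine Finset.sum_congr rfl fun k _ => ?_
  obtain ⟨M, hM⟩ := B.exists_mode_eq_zero (γ.toBasis k) (J.mode b u₁ u₂)
  obtain ⟨M', hM'⟩ := J.truncated (A₁.mode (γ.toBasis k) 0 u₁) u₂ b
  have h := map_finsum (f ∘ₗ (I.mode a).flip u₃)
    (f := fun j : ℕ => B.mode (γ.toBasis k) (-1 - j) (B.mode (γ.toBasis k) j (J.mode b u₁ u₂)))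
    (finite_support_of_bounded (N := M) fun i hi => by rw [hM i hi, map_zero])
  simp only [LinearMap.comp_apply, LinearMap.flip_apply] at h
  -- The single term is spread out as a sum that vanishes for `i ≥ 1`, so that the identity can be
  -- checked termwise.
  have e : f (I.mode (a - 1) (J.mode b u₁ (A₂.mode (γ.toBasis k) 0 u₂))
      (A₃.mode (γ.toBasis k) 0 u₃)) = ∑ᶠ i : ℕ, (-1) ^ i * f (I.mode (a - 1 - i)
        (J.mode b u₁ (A₂.mode (γ.toBasis k) i u₂)) (A₃.mode (γ.toBasis k) 0 u₃)) := by
    rw [finsum_eq_single _ 0 fun i hi => by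
      rw [A₂.mode_top _ (by omega) hu₂]; simp]
    simp
  rw [h, e, ← finsum_add_distrib
    (finite_support_of_bounded (N := 1) fun i hi => by
      rw [A₂.mode_top _ (by omega) hu₂]; simp)
    (finite_support_of_bounded (N := M') fun i hi => by rw [hM' i hi]; simp)]
  refine finsum_congr fun i => ?_
  rw [I.topDual_apply_neg hf _ _ hu₃, J.commutator_top _ hu₁, ← mul_add, Int.cast_natCast,
    add_comm (i : ℂ) b, map_add, LinearMap.add_apply, map_add]

theorem iterateSeries_system (hf : A₄.IsTopDual f) {R : Series₂ (TopTensor A₁ A₂ A₃)}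
    (hR : IsDivAdd 1 (iterateSeries f I J) R) :
    ((ℓ : ℂ) + dualCoxeter γ) • derivFst (iterateSeries f I J) =
        op₂ (Omega12 A₁ A₂ A₃) (divFst (iterateSeries f I J)) + op₂ (Omega13 A₁ A₂ A₃) R ∧
      ((ℓ : ℂ) + dualCoxeter γ) • derivSnd (iterateSeries f I J) =
        op₂ (Omega23 A₁ A₂ A₃) (divSnd (iterateSeries f I J)) + op₂ (Omega13 A₁ A₂ A₃) R := by
  have hRu : ∀ s t (u₁ : A₁.top) (u₂ : A₂.top) (u₃ : A₃.top), R s t ((u₁ ⊗ₜ u₂) ⊗ₜ u₃) =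
      ∑ᶠ i : ℕ, (-1) ^ i * f (I.mode (-t - 1 - 1 - i) (J.mode (-s - 1 + i) u₁ u₂) u₃) := by
    intro s t u₁ u₂ u₃
    rw [(hR s t _).2]
    refine finsum_congr fun i => ?_
    rw [LinearMap.smul_apply, iterateSeries_apply, smul_eq_mul,
      show -(s - (i : ℂ)) - 1 = -s - 1 + i by ring,
      show -(t + 1 + (i : ℂ)) - 1 = -t - 1 - 1 - i by ring]
  constructor
  · funext s t
    refine TensorProduct.ext_threefold fun u₁ u₂ u₃ => ?_
    have e := J.derivative (u₁ : W₁) (-s - 1)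
    rw [show -(-s - 1) = s + 1 by ring] at e
    change ((ℓ : ℂ) + dualCoxeter γ) * ((s + 1) * iterateSeries f I J (s + 1) t _) =
      Omega12 A₁ A₂ A₃ (iterateSeries f I J (s + 1) t) _ + Omega13 A₁ A₂ A₃ (R s t) _
    rw [Omega12_apply, Omega13_apply]
    simp only [hRu, iterateSeries_apply, LModule.coe_topAct,
      show -(s + 1) - 1 = -s - 1 - 1 by ring]
    have e' : (s + 1) * f (I.mode (-t - 1) (J.mode (-s - 1 - 1) u₁ u₂) u₃) =
        f (I.mode (-t - 1) (J.mode (-s - 1) (A₁.L (-1) u₁) u₂) u₃) := by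
      rw [e]; simp
    have hsmul (c : ℂ) (w : W₁) : c * f (I.mode (-t - 1) (J.mode (-s - 1) w u₂) u₃) =
        f (I.mode (-t - 1) (J.mode (-s - 1) (c • w) u₂) u₃) := by simp
    rw [e', hsmul, A₁.L_neg_one_top u₁.2]
    simp only [map_sum, LinearMap.sum_apply]
    rw [← Finset.sum_add_distrib]
    refine Finset.sum_congr rfl fun k _ => ?_
    rw [iterate_apply_neg_one I J hf _ _ u₂.2 u₃.2, add_comm]
  · funext s t
    refine TensorProduct.ext_threefold fun u₁ u₂ u₃ => ?_
    have e := I.derivative (J.mode (-s - 1) u₁ u₂) (-t - 1)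
    rw [show -(-t - 1) = t + 1 by ring] at e
    change ((ℓ : ℂ) + dualCoxeter γ) * ((t + 1) * iterateSeries f I J s (t + 1) _) =
      Omega23 A₁ A₂ A₃ (iterateSeries f I J s (t + 1)) _ + Omega13 A₁ A₂ A₃ (R s t) _
    rw [Omega23_apply, Omega13_apply]
    simp only [hRu, iterateSeries_apply, LModule.coe_topAct,
      show -(t + 1) - 1 = -t - 1 - 1 by ring]
    have e' : (t + 1) * f (I.mode (-t - 1 - 1) (J.mode (-s - 1) u₁ u₂) u₃) =
        f (I.mode (-t - 1) (B.L (-1) (J.mode (-s - 1) u₁ u₂)) u₃) := by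
      rw [e]; simp
    rw [e', iterate_apply_L_neg_one I J hf u₁.2 u₂.2 u₃.2, Finset.sum_add_distrib]

end Iterate

section Product

variable (I : Intertwiner A₁ B A₄) (J : Intertwiner A₂ A₃ B)

theorem truncFst_productSeries (f : Module.Dual ℂ W₄) : TruncFst (productSeries f I J) :=
  truncFst_of_tmul fun u₁ u₂ u₃ s => by
    obtain ⟨N, hN⟩ := J.truncated (u₂ : W₂) (u₃ : W₃) (-s - 1)
    refine ⟨N, fun i hi t => ?_⟩
    rw [productSeries_apply, show -(s - (i : ℂ)) - 1 = -s - 1 + i by ring, hN i hi]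
    simp

theorem finDegree_productSeries (hf : A₄.IsTopDual f) : FinDegree (productSeries f I J) :=
  finDegree_of_tmul fun u₁ u₂ u₃ => by
    obtain ⟨S, hS⟩ := hf.graded
    refine exists_degree_bound (A₁ := A₁) (A₂ := A₂) (A₃ := A₃)
      (fun s t w₁ w₂ w₃ => f (I.mode (-t - 1) w₁ (J.mode (-s - 1) w₂ w₃)))
      (fun _ _ _ _ _ _ => by simp) (fun _ _ _ _ _ _ => by simp) (fun _ _ _ _ _ _ => by simp)
      (S := S) (fun k₁ k₂ k₃ w₁ hw₁ w₂ hw₂ w₃ hw₃ s t hst => ?_) u₁ u₂ u₃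
    by_contra h
    have := I.mode_mem_weightSpace hw₁ (J.mode_mem_weightSpace hw₂ hw₃ (-s - 1)) (-t - 1)
    rw [show k₁ + (k₂ + k₃ - (-s - 1) - 1) - (-t - 1) - 1 = k₁ + k₂ + k₃ + (s + t) by ring] at this
    exact hst (hS _ h _ this)

/-- The functional kills the modes that leave to the left, so `x(-1)` becomes the modes `x(i)`, `i ≥
0`, on the inner product. These act as `x(0)` on `u₂` for every `i` and on `u₃` only for `i = 0`. -/
theorem product_apply_neg_one_left (hf : A₄.IsTopDual f) (x : g) (w₁ : W₁) {u₂ : W₂} {u₃ : W₃}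
    (hu₂ : u₂ ∈ A₂.top) (hu₃ : u₃ ∈ A₃.top) (a b : ℂ) :
    f (I.mode a (A₁.mode x (-1) w₁) (J.mode b u₂ u₃)) =
      ∑ᶠ i : ℕ, f (I.mode (a - 1 - i) w₁ (J.mode (b + i) (A₂.mode x 0 u₂) u₃)) +
        f (I.mode (a - 1) w₁ (J.mode b u₂ (A₃.mode x 0 u₃))) := by
  obtain ⟨M, hM⟩ := J.truncated (A₂.mode x 0 u₂) u₃ b
  have e : f (I.mode (a - 1) w₁ (J.mode b u₂ (A₃.mode x 0 u₃))) =
      ∑ᶠ i : ℕ, f (I.mode (a - 1 - i) w₁ (J.mode b u₂ (A₃.mode x i u₃))) := by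
    rw [finsum_eq_single _ 0 fun i hi => by rw [A₃.mode_top _ (by omega) hu₃]; simp]
    simp
  rw [I.topDual_apply_neg_one hf, e, ← finsum_add_distrib
    (finite_support_of_bounded (N := M) fun i hi => by rw [hM i hi]; simp)
    (finite_support_of_bounded (N := 1) fun i hi => by
      rw [A₃.mode_top _ (by omega) hu₃]; simp)]
  refine finsum_congr fun i => ?_
  rw [J.commutator_top _ hu₂, Int.cast_natCast, add_comm (i : ℂ) b, map_add, map_add, add_comm]

/-- The modes `x(-1 - i)` that leave the inner operator are commuted to the left of the outer one,
where the functional kills them. What remains is minus the commutator, with `x(0)` on `u₁`; hence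
the sign of `Ω₁₂ / (x₁ - x₂)` in the `x₂`-equation. -/
theorem product_apply_neg_one_right (hf : A₄.IsTopDual f) (x : g) {u₁ : W₁} (w₂ : W₂) {u₃ : W₃}
    (hu₁ : u₁ ∈ A₁.top) (hu₃ : u₃ ∈ A₃.top) (a b : ℂ) :
    f (I.mode a u₁ (J.mode b (A₂.mode x (-1) w₂) u₃)) =
      f (I.mode a u₁ (J.mode (b - 1) w₂ (A₃.mode x 0 u₃))) -
        ∑ᶠ i : ℕ, f (I.mode (a - 1 - i) (A₁.mode x 0 u₁) (J.mode (b + i) w₂ u₃)) := by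
  have h := J.apply_neg_one (f ∘ₗ I.mode a u₁) x w₂ hu₃ b
  simp only [LinearMap.comp_apply] at h
  rw [h, add_comm, sub_eq_add_neg (f _), ← finsum_neg_distrib]
  congr 1
  refine finsum_congr fun i => ?_
  have h' := congrArg f (I.commutator_top x hu₁ (J.mode (b + i) w₂ u₃) (-1 - i) a)
  rw [A₄.topDual_mode hf _ (by omega), map_add,
    show ((-1 - (i : ℤ) : ℤ) : ℂ) + a = a - 1 - i by push_cast; ring] at h'
  exact eq_neg_of_add_eq_zero_left h'.symm

theorem productSeries_system (hf : A₄.IsTopDual f) {R : Series₂ (TopTensor A₁ A₂ A₃)}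
    (hR : IsDivAdd (-1) (productSeries f I J) R) :
    ((ℓ : ℂ) + dualCoxeter γ) • derivSnd (productSeries f I J) =
        op₂ (Omega12 A₁ A₂ A₃) R + op₂ (Omega13 A₁ A₂ A₃) (divSnd (productSeries f I J)) ∧
      ((ℓ : ℂ) + dualCoxeter γ) • derivFst (productSeries f I J) =
        op₂ (Omega23 A₁ A₂ A₃) (divFst (productSeries f I J)) - op₂ (Omega12 A₁ A₂ A₃) R := by
  have hRu : ∀ s t (u₁ : A₁.top) (u₂ : A₂.top) (u₃ : A₃.top), R s t ((u₁ ⊗ₜ u₂) ⊗ₜ u₃) =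
      ∑ᶠ i : ℕ, f (I.mode (-t - 1 - 1 - i) u₁ (J.mode (-s - 1 + i) u₂ u₃)) := by
    intro s t u₁ u₂ u₃
    rw [(hR s t _).2]
    refine finsum_congr fun i => ?_
    rw [LinearMap.smul_apply, productSeries_apply, neg_neg, one_pow, one_smul,
      show -(s - (i : ℂ)) - 1 = -s - 1 + i by ring,
      show -(t + 1 + (i : ℂ)) - 1 = -t - 1 - 1 - i by ring]
  constructor
  · funext s t
    refine TensorProduct.ext_threefold fun u₁ u₂ u₃ => ?_
    have e := I.derivative (u₁ : W₁) (-t - 1)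
    rw [show -(-t - 1) = t + 1 by ring] at e
    change ((ℓ : ℂ) + dualCoxeter γ) * ((t + 1) * productSeries f I J s (t + 1) _) =
      Omega12 A₁ A₂ A₃ (R s t) _ + Omega13 A₁ A₂ A₃ (productSeries f I J s (t + 1)) _
    rw [Omega12_apply, Omega13_apply]
    simp only [hRu, productSeries_apply, LModule.coe_topAct,
      show -(t + 1) - 1 = -t - 1 - 1 by ring]
    have e' : (t + 1) * f (I.mode (-t - 1 - 1) u₁ (J.mode (-s - 1) u₂ u₃)) =
        f (I.mode (-t - 1) (A₁.L (-1) u₁) (J.mode (-s - 1) u₂ u₃)) := by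
      rw [e]; simp
    have hsmul (c : ℂ) (w : W₁) : c * f (I.mode (-t - 1) w (J.mode (-s - 1) u₂ u₃)) =
        f (I.mode (-t - 1) (c • w) (J.mode (-s - 1) u₂ u₃)) := by simp
    rw [e', hsmul, A₁.L_neg_one_top u₁.2]
    simp only [map_sum, LinearMap.sum_apply]
    rw [← Finset.sum_add_distrib]
    refine Finset.sum_congr rfl fun k _ => ?_
    rw [product_apply_neg_one_left I J hf _ _ u₂.2 u₃.2]
  · funext s t
    refine TensorProduct.ext_threefold fun u₁ u₂ u₃ => ?_
    have e := J.derivative (u₂ : W₂) (-s - 1)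
    rw [show -(-s - 1) = s + 1 by ring] at e
    change ((ℓ : ℂ) + dualCoxeter γ) * ((s + 1) * productSeries f I J (s + 1) t _) =
      Omega23 A₁ A₂ A₃ (productSeries f I J (s + 1) t) _ - Omega12 A₁ A₂ A₃ (R s t) _
    rw [Omega23_apply, Omega12_apply]
    simp only [hRu, productSeries_apply, LModule.coe_topAct,
      show -(s + 1) - 1 = -s - 1 - 1 by ring]
    have e' : (s + 1) * f (I.mode (-t - 1) u₁ (J.mode (-s - 1 - 1) u₂ u₃)) =
        f (I.mode (-t - 1) u₁ (J.mode (-s - 1) (A₂.L (-1) u₂) u₃)) := by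
      rw [e]; simp
    have hsmul (c : ℂ) (w : W₂) : c * f (I.mode (-t - 1) u₁ (J.mode (-s - 1) w u₃)) =
        f (I.mode (-t - 1) u₁ (J.mode (-s - 1) (c • w) u₃)) := by simp
    rw [e', hsmul, A₂.L_neg_one_top u₂.2]
    simp only [map_sum, LinearMap.sum_apply]
    rw [← Finset.sum_sub_distrib]
    refine Finset.sum_congr rfl fun k _ => ?_
    rw [product_apply_neg_one_right I J hf _ _ u₁.2 u₃.2]

end Product

end Correlators

end

end AffineKZ

/-! ### Assembly of the theorem -/

theorem theorem5p2 {g : Type*} [LieRing g] [LieAlgebra ℂ g] [FiniteDimensional ℂ g]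
    [LieAlgebra.IsSimple ℂ g] (H : LieSubalgebra ℂ g) [H.IsCartanSubalgebra]
    {ι : Type*} [Fintype ι] [DecidableEq ι] (γ : AffineKZ.OrthoBasis H ι) (ℓ : ℕ)
    {W₁ W₂ W₃ W₄ M₁ M₂ : Type*} [AddCommGroup W₁] [Module ℂ W₁] [AddCommGroup W₂] [Module ℂ W₂]
    [AddCommGroup W₃] [Module ℂ W₃] [AddCommGroup W₄] [Module ℂ W₄]
    [AddCommGroup M₁] [Module ℂ M₁] [AddCommGroup M₂] [Module ℂ M₂]
    (A₁ : AffineKZ.LModule ℓ γ W₁) (A₂ : AffineKZ.LModule ℓ γ W₂)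
    (A₃ : AffineKZ.LModule ℓ γ W₃) (A₄ : AffineKZ.LModule ℓ γ W₄)
    (B₁ : AffineKZ.LModule ℓ γ M₁) (B₂ : AffineKZ.LModule ℓ γ M₂)
    (f : Module.Dual ℂ W₄) (hf : A₄.IsTopDual f) :
    -- Iterates; the series variables are `x₀, x₂`, and after the substitution `x₀, x₁`.
    (∀ (I : AffineKZ.Intertwiner B₂ A₃ A₄) (J : AffineKZ.Intertwiner A₁ A₂ B₂),
      let φ := AffineKZ.iterateSeries f I J
      let κ : ℂ := (ℓ : ℂ) + AffineKZ.dualCoxeter γ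
      let Ω₁₂ := AffineKZ.Omega12 A₁ A₂ A₃
      let Ω₁₃ := AffineKZ.Omega13 A₁ A₂ A₃
      let Ω₂₃ := AffineKZ.Omega23 A₁ A₂ A₃
      (∃ R, AffineKZ.IsDivAdd 1 φ R ∧
        κ • AffineKZ.derivFst φ =
          AffineKZ.op₂ Ω₁₂ (AffineKZ.divFst φ) + AffineKZ.op₂ Ω₁₃ R ∧
        κ • AffineKZ.derivSnd φ =
          AffineKZ.op₂ Ω₂₃ (AffineKZ.divSnd φ) + AffineKZ.op₂ Ω₁₃ R) ∧
      ∃ Φ, AffineKZ.IsShift φ Φ ∧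
        (∃ R, AffineKZ.IsDivAdd (-1) Φ R ∧
          κ • AffineKZ.derivFst Φ =
            AffineKZ.op₂ Ω₁₂ (AffineKZ.divFst Φ) - AffineKZ.op₂ Ω₂₃ R ∧
          κ • AffineKZ.derivSnd Φ =
            AffineKZ.op₂ Ω₂₃ R + AffineKZ.op₂ Ω₁₃ (AffineKZ.divSnd Φ)) ∧
        ∃ G, AffineKZ.IsPowMulComp (AffineKZ.Htilde A₁ A₂ A₃) G Φ ∧
          ∃ R, AffineKZ.IsDivOneSub G R ∧
            κ • AffineKZ.deriv₁ G =
              AffineKZ.op₁ Ω₁₂ (AffineKZ.div₁ G) - AffineKZ.op₁ Ω₂₃ R) ∧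
    -- Products; the series variables are `x₂, x₁`.
    (∀ (I : AffineKZ.Intertwiner A₁ B₁ A₄) (J : AffineKZ.Intertwiner A₂ A₃ B₁),
      let ψ := AffineKZ.productSeries f I J
      let κ : ℂ := (ℓ : ℂ) + AffineKZ.dualCoxeter γ
      let Ω₁₂ := AffineKZ.Omega12 A₁ A₂ A₃
      let Ω₁₃ := AffineKZ.Omega13 A₁ A₂ A₃
      let Ω₂₃ := AffineKZ.Omega23 A₁ A₂ A₃
      (∃ R, AffineKZ.IsDivAdd (-1) ψ R ∧
        κ • AffineKZ.derivSnd ψ =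
          AffineKZ.op₂ Ω₁₂ R + AffineKZ.op₂ Ω₁₃ (AffineKZ.divSnd ψ) ∧
        κ • AffineKZ.derivFst ψ =
          AffineKZ.op₂ Ω₂₃ (AffineKZ.divFst ψ) - AffineKZ.op₂ Ω₁₂ R) ∧
      ∃ F, AffineKZ.IsPowMulComp (AffineKZ.Htilde A₁ A₂ A₃) F ψ ∧
        ∃ R, AffineKZ.IsDivOneSub F R ∧
          κ • AffineKZ.deriv₁ F =
            AffineKZ.op₁ Ω₂₃ (AffineKZ.div₁ F) - AffineKZ.op₁ Ω₁₂ R) := by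
  have hκ := AffineKZ.level_add_dualCoxeter_ne_zero γ ℓ
  constructor
  · intro I J φ κ Ω₁₂ Ω₁₃ Ω₂₃
    have hT : AffineKZ.TruncFst φ := AffineKZ.truncFst_iterateSeries I J f
    obtain ⟨R, hR⟩ := AffineKZ.exists_isDivAdd hT 1
    obtain ⟨h₁, h₂⟩ := AffineKZ.iterateSeries_system I J hf hR
    refine ⟨⟨R, hR, h₁, h₂⟩, ?_⟩
    obtain ⟨Φ, hΦ⟩ := AffineKZ.exists_isShift hT
    rw [AffineKZ.Omega12_eq_dualMap, AffineKZ.Omega13_eq_dualMap] at h₁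
    rw [AffineKZ.Omega23_eq_dualMap, AffineKZ.Omega13_eq_dualMap] at h₂
    obtain ⟨Q, hQ, h₃, h₄⟩ := AffineKZ.IsShift.system hT hΦ hR h₁ h₂
    obtain ⟨G, hG, V, hV, h₅⟩ := AffineKZ.exists_isPowMulComp_of_system
      (AffineKZ.IsShift.truncFst hT hΦ)
      (AffineKZ.IsShift.finDegree (AffineKZ.finDegree_iterateSeries I J hf) hΦ) hQ hκ h₃ h₄
    simp only [← AffineKZ.Omega12_eq_dualMap, ← AffineKZ.Omega13_eq_dualMap,
      ← AffineKZ.Omega23_eq_dualMap] at h₃ h₄ h₅ hG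
    rw [add_right_comm] at hG
    exact ⟨Φ, hΦ, ⟨Q, hQ, h₃, h₄⟩, G, hG, V, hV, h₅⟩
  · intro I J ψ κ Ω₁₂ Ω₁₃ Ω₂₃
    have hT : AffineKZ.TruncFst ψ := AffineKZ.truncFst_productSeries I J f
    obtain ⟨R, hR⟩ := AffineKZ.exists_isDivAdd hT (-1)
    obtain ⟨h₁, h₂⟩ := AffineKZ.productSeries_system I J hf hR
    refine ⟨⟨R, hR, h₁, h₂⟩, ?_⟩
    rw [AffineKZ.Omega12_eq_dualMap, AffineKZ.Omega13_eq_dualMap] at h₁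
    rw [AffineKZ.Omega23_eq_dualMap, AffineKZ.Omega12_eq_dualMap] at h₂
    -- Here `Ω₂₃` belongs to the pole at `x = 0` and `Ω₁₂` to the pole at `x = y`, the reverse of
    -- the iterate case; the sum defining `H̃` is reordered accordingly below.
    obtain ⟨F, hF, V, hV, h₃⟩ := AffineKZ.exists_isPowMulComp_of_system hT
      (AffineKZ.finDegree_productSeries I J hf) hR hκ h₂ h₁
    simp only [← AffineKZ.Omega12_eq_dualMap, ← AffineKZ.Omega13_eq_dualMap,
      ← AffineKZ.Omega23_eq_dualMap] at h₃ hF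
    rw [add_assoc, add_comm (AffineKZ.Omega23 A₁ A₂ A₃)] at hF
    exact ⟨F, hF, V, hV, h₃⟩
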